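/- **Theorem 1.1.** *Notation.* For a metric space $X$ and a domain (nonempty connected open set) $G\subsetneq X$ put $\delta_G(z)=\operatorname{dist}(z,\partial G)$; let $\mathbb B^G(z,r)$ be the connected component containing $z$ of $\{w\in G: |w-z|<r\}$; and let $k_G(x,y)=\inf_\gamma\int_\gamma\frac{|dz|}{\delta_G(z)}$ be the quasihyperbolic distance, the infimum being over all rectifiable curves $\gamma$ in $G$ joining $x$ and $y$. For $c\ge 1$, $X$ is *$c$-quasiconvex* if any $x,y\in X$ can be joined by a curve of length at most $c\,|x-y|$. Let $f:G\to G'$ be a homeomorphism between domains $G\subsetneq X$ and $G'\subsetneq Y$. For a function $\varphi:[0,\infty)\to[0,\infty)$, $f$ is *$\varphi$-semisolid in a subdomain* $D\subseteq G$ if $k_{f(D)}(f(x),f(y))\le\varphi(k_D(x,y))$ for all $x,y\in D$. For $0<q<1$ and $H\ge1$, $f$ is *$q$-locally weakly $H$-quasisymmetric in $G$* if for every $z\in G$ and all $x,a,b\in\mathbb B^G(z,q\,\delta_G(z))$, $|x-a|\le|x-b|$ implies $|f(x)-f(a)|\le H|f(x)-f(b)|$. *Statement.* Let $X$ be a $c$-quasiconvex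 and complete metric space, $Y$ a $c'$-quasiconvex metric space, and $f:G\to G'$ a homeomorphism, where $G\subsetneq X$ and $G'\subsetneq Y$ are domains. Then the following are equivalent: 1. there is a homeomorphism $\varphi:[0,\infty)\to[0,\infty)$ such that $f$ is $\varphi$-semisolid in every subdomain of $G$ (including $G$ itself); 2. there are constants $\mu>0$ and $0<\alpha<1$ such that $f$ is $\varphi_1$-semisolid in every subdomain of $G$, where $\varphi_1(t)=\mu\max\{t^\alpha,t\}$; 3. there are constants $H\ge1$ and $0<q<1$ such that $f$ is $q$-locally weakly $H$-quasisymmetric in $G$. Moreover, the data $\varphi$, $(\mu,\alpha)$ and $(H,q)$ depend only on each other and on $c,c'$: if one of the three conditions holds with given data, then each of the other two holds with data depending only on the given data and on $c$ and $c'$ (not on $X$, $Y$, $G$, $G'$ or $f$). -/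

import Mathlib

open Set MeasureTheory
open scoped ENNReal NNReal

universe u v

noncomputable section

section Curves

variable {X : Type*} [MetricSpace X]

/-- `γ` restricted to `[a, b]` is a curve (a continuous map on a compact interval) from `x` to `y`. -/
structure IsCurve (γ : ℝ → X) (a b : ℝ) (x y : X) : Prop where
  le : a ≤ b
  continuousOn : ContinuousOn γ (Icc a b)
  left : γ a = x
  right : γ b = y

/-- The length of the curve `γ : [a, b] → X`, a supremum of sums over partitions. -/
def curveLength (γ : ℝ → X) (a b : ℝ) : ℝ≥0∞ :=
  eVariationOn γ (Icc a b)

/-- The arclength parametrization `γ_s : [0, ℓ(γ)] → X` of the rectifiable curve `γ : [a, b] → X`. -/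
def arclengthParam (γ : ℝ → X) (a b : ℝ) : ℝ → X :=
  naturalParameterization γ (Icc a b) a

/-- The line integral `∫_γ ρ ds = ∫_0^{ℓ(γ)} ρ (γ_s t) dt` over the rectifiable curve
`γ : [a, b] → X`. -/
def lineIntegral (ρ : X → ℝ≥0∞) (γ : ℝ → X) (a b : ℝ) : ℝ≥0∞ :=
  ∫⁻ t in Icc 0 (curveLength γ a b).toReal, ρ (arclengthParam γ a b t)

end Curves

/-- `X` is `c`-quasiconvex, where `c ≥ 1`: any two points `x`, `y` are joined by a curve of length
at most `c` times their distance. -/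
def IsQuasiconvexSpace (c : ℝ) (X : Type*) [MetricSpace X] : Prop :=
  1 ≤ c ∧ ∀ x y : X, ∃ (γ : ℝ → X) (a b : ℝ),
    IsCurve γ a b x y ∧ curveLength γ a b ≤ ENNReal.ofReal (c * dist x y)

section Domains

variable {X : Type*} [MetricSpace X]

/-- A domain: a nonempty, open and connected set. -/
def IsDomainSet (G : Set X) : Prop :=
  IsOpen G ∧ IsConnected G

/-- A domain which is not the whole space. -/
def IsProperDomain (G : Set X) : Prop :=
  IsDomainSet G ∧ G ≠ univ

/-- `δ_G(z)`, the distance from `z` to the boundary of `G`. -/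
def boundaryDist (G : Set X) (z : X) : ℝ :=
  Metric.infDist z (frontier G)

/-- `𝔹^G(z, r)`, the component containing `z` of the intersection of `G` with the open ball of
center `z` and radius `r`. -/
def componentBall (G : Set X) (z : X) (r : ℝ) : Set X :=
  connectedComponentIn (Metric.ball z r ∩ G) z

/-- The quasihyperbolic length `∫_γ |dz| / δ_G(z)` of a rectifiable curve in `G`. -/
def qhLength (G : Set X) (γ : ℝ → X) (a b : ℝ) : ℝ≥0∞ :=
  lineIntegral (fun z => (ENNReal.ofReal (boundaryDist G z))⁻¹) γ a b

/-- The quasihyperbolic distance `k_G(x, y)`: the infimum of the quasihyperbolic lengths of the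
rectifiable curves in `G` from `x` to `y`. -/
def qhDist (G : Set X) (x y : X) : ℝ≥0∞ :=
  ⨅ (γ : ℝ → X) (a : ℝ) (b : ℝ) (_ : IsCurve γ a b x y ∧ curveLength γ a b ≠ ∞ ∧
    MapsTo γ (Icc a b) G), qhLength G γ a b

end Domains

section Maps

variable {X Y : Type*} [MetricSpace X] [MetricSpace Y]

/-- `f : D → f(D)` is `φ`-semisolid: `k_{f(D)}(f(x), f(y)) ≤ φ(k_D(x, y))` for all `x, y ∈ D`.
(As `φ` is defined on `[0, ∞)`, the distance `k_D(x, y)`, which is finite on every domain of a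
quasiconvex space, is written there as a nonnegative real `t`.) -/
def IsSemisolidOn (φ : ℝ≥0 → ℝ≥0) (f : X → Y) (D : Set X) : Prop :=
  ∀ x ∈ D, ∀ y ∈ D, ∀ t : ℝ≥0, qhDist D x y = (t : ℝ≥0∞) →
    qhDist (f '' D) (f x) (f y) ≤ (φ t : ℝ≥0∞)

/-- `f : G → f(G)` is `φ`-semisolid in every subdomain of `G` (`G` itself being one of them). -/
def IsSemisolidInSubdomains (φ : ℝ≥0 → ℝ≥0) (f : X → Y) (G : Set X) : Prop :=
  ∀ D ⊆ G, IsDomainSet D → IsSemisolidOn φ f D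

/-- `f` is weakly `H`-quasisymmetric on the set `A`. -/
def IsWeaklyQuasisymmetricOn (H : ℝ) (f : X → Y) (A : Set X) : Prop :=
  ∀ x ∈ A, ∀ a ∈ A, ∀ b ∈ A, dist x a ≤ dist x b → dist (f x) (f a) ≤ H * dist (f x) (f b)

/-- `f` is `q`-locally weakly `H`-quasisymmetric in `G`. -/
def IsLocallyWeaklyQuasisymmetric (q H : ℝ) (f : X → Y) (G : Set X) : Prop :=
  ∀ z ∈ G, IsWeaklyQuasisymmetricOn H f (componentBall G z (q * boundaryDist G z))

/-- The standing assumptions: `X` is `c`-quasiconvex and complete, `Y` is `c'`-quasiconvex, and `f`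
is a homeomorphism of the proper domain `G = f.source` of `X` onto the proper domain
`G' = f.target` of `Y`. -/
structure IsProperDomainHomeo (c c' : ℝ) (f : OpenPartialHomeomorph X Y) : Prop where
  quasiconvex_left : IsQuasiconvexSpace c X
  complete_left : CompleteSpace X
  quasiconvex_right : IsQuasiconvexSpace c' Y
  source_domain : IsProperDomain f.source
  target_domain : IsProperDomain f.target

end Maps

/-- The control function `φ₁(t) = μ · max {t ^ α, t}`. -/
def powerControl (μ : ℝ≥0) (α : ℝ) (t : ℝ≥0) : ℝ≥0 :=
  μ * max (t ^ α) t

end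

/-! (1) ⇒ (3): puncture the domain. If `|u - p| ≤ δ_G(u)`, let `D` be the component of `G \ {p}`
containing `u`; then `p` is a boundary point of `D` and `f p` one of `f '' D`. When `|u - v| ≤ |u -
p| / (2c)`, a short path gives `k_D(u, v) ≤ 1`, so `f v` is at bounded quasihyperbolic distance from
`f u` in `f '' D`. The logarithmic lower bound `log_le_qhDist` turns this into `|f u - f v| ≤ C |f u
- f p|` (`IsSemisolidInSubdomains.dist_le_exp_mul`), and chaining along a path
(`IsLipPath.dist_image_le`) raises the ratio `1 / (2c)` to `1`.

(3) ⇒ (2): completeness of `X` makes images of small closed balls closed in `Y`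
(`isClosed_image_closedBall`), so a path leaving the image of a ball crosses the image of its
sphere. A path from `f x` to `f p`, with `|x - p| = r`, therefore crosses the images of the spheres
of radii `r / 2 ^ i`, `1 ≤ i ≤ n`. Weak quasisymmetry makes every layer cost length at least `|f x -
f a| / H ^ 2` when `|x - a| ≤ r / 2 ^ n`. As some path has length at most `c' |f x - f p|`, a large
fixed `n` forces `|f x - f a| ≤ |f x - f p| / 2`. Iteration yields Hölder decay with exponent `1 /
n`, hence a Hölder bound between `k_D` and `k_{f(D)}` at small scales; cutting almost minimal paths
into short pieces gives the linear bound at large scales.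

(2) ⇒ (1): `φ₁` is itself a homeomorphism. -/

/-! ### Arclength and 1-Lipschitz paths -/

section LipschitzPaths

variable {X : Type*} [MetricSpace X]

/-- `g` restricted to `[0, L]` is a `1`-Lipschitz path from `x` to `y`. -/
structure IsLipPath (g : ℝ → X) (L : ℝ) (x y : X) : Prop where
  nonneg : 0 ≤ L
  lip : LipschitzOnWith 1 g (Icc 0 L)
  left : g 0 = x
  right : g L = y

theorem variationOnFromTo_continuousOn {s : Set ℝ} {γ : ℝ → X} {a : ℝ} (ha : a ∈ s)
    (hc : ContinuousOn γ s) (hb : LocallyBoundedVariationOn γ s) :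
    ContinuousOn (variationOnFromTo γ s a) s := by
  intro t ht
  have hl : ContinuousWithinAt (variationOnFromTo γ s a) (s ∩ Iio t) t := by
    have h := variationOnFromTo.tendsto_left ha ht hb
      ((hc t ht).mono_left (nhdsWithin_mono _ inter_subset_left))
    simpa [ContinuousWithinAt] using h
  have hr : ContinuousWithinAt (variationOnFromTo γ s a) (s ∩ Ioi t) t := by
    have h := variationOnFromTo.tendsto_right ha ht hb
      ((hc t ht).mono_left (nhdsWithin_mono _ inter_subset_left))
    simpa [ContinuousWithinAt] using h
  have h := continuousWithinAt_insert_self.2 (hl.union hr)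
  refine h.mono fun u hu => ?_
  rcases lt_trichotomy u t with h1 | h1 | h1
  · exact Or.inr (Or.inl ⟨hu, h1⟩)
  · exact Or.inl h1
  · exact Or.inr (Or.inr ⟨hu, h1⟩)

theorem variationOnFromTo_left_right {γ : ℝ → X} {a b : ℝ} (hab : a ≤ b) :
    variationOnFromTo γ (Icc a b) a b = (eVariationOn γ (Icc a b)).toReal := by
  rw [variationOnFromTo.eq_of_le _ _ hab, inter_self]

theorem variationOnFromTo_image_Icc {γ : ℝ → X} {a b : ℝ} (hab : a ≤ b)
    (hc : ContinuousOn γ (Icc a b)) (hb : BoundedVariationOn γ (Icc a b)) :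
    variationOnFromTo γ (Icc a b) a '' Icc a b = Icc 0 (eVariationOn γ (Icc a b)).toReal := by
  have hb' := hb.locallyBoundedVariationOn
  have ha : a ∈ Icc a b := left_mem_Icc.2 hab
  have hm := variationOnFromTo.monotoneOn hb' ha
  rw [← variationOnFromTo_left_right hab]
  apply Subset.antisymm
  · rintro _ ⟨t, ht, rfl⟩
    refine ⟨?_, hm ht (right_mem_Icc.2 hab) ht.2⟩
    simpa [variationOnFromTo.self] using hm ha ht ht.1
  · have := intermediate_value_Icc hab (variationOnFromTo_continuousOn ha hc hb')
    simpa [variationOnFromTo.self] using this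

/-- Unit speed bounds distances by parameter differences. This allows every later argument to use
1-Lipschitz paths on `[0, L]` in place of rectifiable curves. -/
theorem IsCurve.isLipPath_arclengthParam {γ : ℝ → X} {a b : ℝ} {x y : X} (h : IsCurve γ a b x y)
    (hl : curveLength γ a b ≠ ∞) :
    IsLipPath (arclengthParam γ a b) (curveLength γ a b).toReal x y ∧
      MapsTo (arclengthParam γ a b) (Icc 0 (curveLength γ a b).toReal) (γ '' Icc a b) := by
  have hb : BoundedVariationOn γ (Icc a b) := hl
  have hb' := hb.locallyBoundedVariationOn
  have ha : a ∈ Icc a b := left_mem_Icc.2 h.le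
  have himg : variationOnFromTo γ (Icc a b) a '' Icc a b = Icc 0 (curveLength γ a b).toReal :=
    variationOnFromTo_image_Icc h.le h.continuousOn hb
  have hval : ∀ t ∈ Icc a b,
      arclengthParam γ a b (variationOnFromTo γ (Icc a b) a t) = γ t := fun t ht =>
    edist_eq_zero.1 (edist_naturalParameterization_eq_zero hb' ha ht)
  refine ⟨⟨ENNReal.toReal_nonneg, ?_, ?_, ?_⟩, ?_⟩
  · have hu := has_unit_speed_naturalParameterization γ hb' ha
    rw [himg] at hu
    have key : ∀ s ∈ Icc 0 (curveLength γ a b).toReal, ∀ t ∈ Icc 0 (curveLength γ a b).toReal,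
        s ≤ t → dist (arclengthParam γ a b s) (arclengthParam γ a b t) ≤ dist s t := by
      intro s hs t ht hst
      have h1 := eVariationOn.edist_le (arclengthParam γ a b)
        (s := Icc 0 (curveLength γ a b).toReal ∩ Icc s t) ⟨hs, left_mem_Icc.2 hst⟩
        ⟨ht, right_mem_Icc.2 hst⟩
      have h2 := hu hs ht
      unfold arclengthParam at h1
      rw [h2, edist_dist] at h1
      rw [dist_comm s t, Real.dist_eq, abs_of_nonneg (sub_nonneg.2 hst)]
      simpa [arclengthParam] using (ENNReal.ofReal_le_ofReal_iff (by simpa using hst)).1 h1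
    refine LipschitzOnWith.of_dist_le_mul fun s hs t ht => ?_
    rw [NNReal.coe_one, one_mul]
    rcases le_total s t with hst | hst
    · exact key s hs t ht hst
    · rw [dist_comm, dist_comm s t]
      exact key t ht s hs hst
  · rw [← h.left, ← hval a ha, variationOnFromTo.self]
  · rw [← h.right, ← hval b (right_mem_Icc.2 h.le), variationOnFromTo_left_right h.le]
    rfl
  · rw [← himg]
    rintro _ ⟨t, ht, rfl⟩
    exact ⟨t, ht, (hval t ht).symm⟩

theorem IsLipPath.isCurve {g : ℝ → X} {L : ℝ} {x y : X} (h : IsLipPath g L x y) :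
    IsCurve g 0 L x y :=
  ⟨h.nonneg, h.lip.continuousOn, h.left, h.right⟩

theorem LipschitzOnWith.eVariationOn_Icc_le {g : ℝ → X} {S : Set ℝ} (h : LipschitzOnWith 1 g S)
    {s t : ℝ} (hst : Icc s t ⊆ S) : eVariationOn g (Icc s t) ≤ ENNReal.ofReal (t - s) := by
  have := h.comp_eVariationOn_le (g := id) (s := Icc s t) hst
  simpa [eVariationOn_id_Icc] using this

theorem IsLipPath.curveLength_ne_top {g : ℝ → X} {L : ℝ} {x y : X} (h : IsLipPath g L x y) :
    curveLength g 0 L ≠ ∞ :=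
  ne_top_of_le_ne_top ENNReal.ofReal_ne_top (h.lip.eVariationOn_Icc_le Subset.rfl)

/-- The length function `V` of `g` is 1-Lipschitz, so it does not increase one-dimensional Hausdorff
measure. Hence Lebesgue measure on `[0, ℓ(g)]` is dominated by the push-forward of Lebesgue measure
on `[0, L]`; no measurability of `ρ` is needed. -/
theorem IsLipPath.lineIntegral_le {g : ℝ → X} {L : ℝ} {x y : X} (h : IsLipPath g L x y)
    (ρ : X → ℝ≥0∞) : lineIntegral ρ g 0 L ≤ ∫⁻ t in Icc 0 L, ρ (g t) := by
  have hb : BoundedVariationOn g (Icc 0 L) := h.curveLength_ne_top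
  have hb' := hb.locallyBoundedVariationOn
  have h0 : (0 : ℝ) ∈ Icc 0 L := left_mem_Icc.2 h.nonneg
  set V := variationOnFromTo g (Icc 0 L) 0
  have himg : V '' Icc 0 L = Icc 0 (curveLength g 0 L).toReal :=
    variationOnFromTo_image_Icc h.nonneg h.lip.continuousOn hb
  have hval : ∀ t ∈ Icc 0 L, arclengthParam g 0 L (V t) = g t := fun t ht =>
    edist_eq_zero.1 (edist_naturalParameterization_eq_zero hb' h0 ht)
  have hkey : ∀ s ∈ Icc 0 L, ∀ t ∈ Icc 0 L, s ≤ t → dist (V s) (V t) ≤ dist s t := by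
    intro s hs t ht hst
    have h1 : V s + variationOnFromTo g (Icc 0 L) s t = V t :=
      variationOnFromTo.add hb' h0 hs ht
    have h2 := h.lip.eVariationOn_Icc_le (Icc_subset_Icc hs.1 ht.2)
    have h3 : variationOnFromTo g (Icc 0 L) s t ≤ t - s := by
      rw [variationOnFromTo.eq_of_le _ _ hst]
      refine ENNReal.toReal_le_of_le_ofReal (sub_nonneg.2 hst) (le_trans ?_ h2)
      exact eVariationOn.mono _ inter_subset_right
    have h4 := variationOnFromTo.nonneg_of_le g (Icc 0 L) hst
    rw [dist_comm, dist_comm s t, Real.dist_eq, Real.dist_eq, ← h1, add_sub_cancel_left,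
      abs_of_nonneg h4, abs_of_nonneg (sub_nonneg.2 hst)]
    exact h3
  have hVlip : LipschitzOnWith 1 V (Icc 0 L) := by
    refine LipschitzOnWith.of_dist_le_mul fun s hs t ht => ?_
    rw [NNReal.coe_one, one_mul]
    rcases le_total s t with hst | hst
    · exact hkey s hs t ht hst
    · rw [dist_comm, dist_comm s t]
      exact hkey t ht s hs hst
  have hVm : AEMeasurable V (volume.restrict (Icc 0 L)) :=
    hVlip.continuousOn.aemeasurable measurableSet_Icc
  have hmeas : volume.restrict (Icc 0 (curveLength g 0 L).toReal) ≤
      (volume.restrict (Icc 0 L)).map V := by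
    refine Measure.le_iff.2 fun A hA => ?_
    rw [Measure.map_apply_of_aemeasurable hVm hA, Measure.restrict_apply' measurableSet_Icc,
      Measure.restrict_apply' measurableSet_Icc, ← himg]
    have hsub : A ∩ V '' Icc 0 L ⊆ V '' (V ⁻¹' A ∩ Icc 0 L) := by
      rintro _ ⟨hA, t, ht, rfl⟩
      exact ⟨t, ⟨hA, ht⟩, rfl⟩
    refine (measure_mono hsub).trans ?_
    have := (hVlip.mono (inter_subset_right (s := V ⁻¹' A))).hausdorffMeasure_image_le
      (d := 1) zero_le_one
    simpa [hausdorffMeasure_real] using this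
  calc lineIntegral ρ g 0 L
      ≤ ∫⁻ t, ρ (arclengthParam g 0 L t) ∂((volume.restrict (Icc 0 L)).map V) :=
        lintegral_mono' hmeas le_rfl
    _ ≤ ∫⁻ t in Icc 0 L, ρ (arclengthParam g 0 L (V t)) := lintegral_map_le _ _
    _ = ∫⁻ t in Icc 0 L, ρ (g t) :=
        setLIntegral_congr_fun measurableSet_Icc fun t ht => by rw [hval t ht]

theorem IsLipPath.dist_le {g : ℝ → X} {L : ℝ} {x y : X} (h : IsLipPath g L x y) {s t : ℝ}
    (hs : s ∈ Icc 0 L) (ht : t ∈ Icc 0 L) : dist (g s) (g t) ≤ |s - t| := by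
  simpa [Real.dist_eq] using h.lip.dist_le_mul s hs t ht

theorem IsLipPath.dist_left_le {g : ℝ → X} {L : ℝ} {x y : X} (h : IsLipPath g L x y) {t : ℝ}
    (ht : t ∈ Icc 0 L) : dist x (g t) ≤ t := by
  have := h.dist_le (left_mem_Icc.2 h.nonneg) ht
  rwa [h.left, zero_sub, abs_neg, abs_of_nonneg ht.1] at this

theorem IsLipPath.dist_endpoints_le {g : ℝ → X} {L : ℝ} {x y : X} (h : IsLipPath g L x y) :
    dist x y ≤ L := by
  have := h.dist_left_le (right_mem_Icc.2 h.nonneg)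
  rwa [h.right] at this

theorem IsLipPath.sub {g : ℝ → X} {L : ℝ} {x y : X} (h : IsLipPath g L x y) {s t : ℝ}
    (hs : 0 ≤ s) (hst : s ≤ t) (ht : t ≤ L) :
    IsLipPath (fun u => g (u + s)) (t - s) (g s) (g t) := by
  refine ⟨sub_nonneg.2 hst, ?_, by simp, by simp⟩
  refine LipschitzOnWith.of_dist_le_mul fun u hu v hv => ?_
  have := h.dist_le (s := u + s) (t := v + s) ⟨by linarith [hu.1], by linarith [hu.2]⟩
    ⟨by linarith [hv.1], by linarith [hv.2]⟩
  simpa [Real.dist_eq] using this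

theorem IsLipPath.take {g : ℝ → X} {L : ℝ} {x y : X} (h : IsLipPath g L x y) {t : ℝ}
    (ht : t ∈ Icc 0 L) : IsLipPath g t x (g t) :=
  ⟨ht.1, h.lip.mono (Icc_subset_Icc_right ht.2), h.left, rfl⟩

theorem IsLipPath.trans {g₁ g₂ : ℝ → X} {L₁ L₂ : ℝ} {x y z : X} (h₁ : IsLipPath g₁ L₁ x y)
    (h₂ : IsLipPath g₂ L₂ y z) :
    IsLipPath (fun t => if t ≤ L₁ then g₁ t else g₂ (t - L₁)) (L₁ + L₂) x z := by
  have hval : ∀ t, L₁ ≤ t → (if t ≤ L₁ then g₁ t else g₂ (t - L₁)) = g₂ (t - L₁) := by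
    intro t ht
    split_ifs with h
    · rw [le_antisymm h ht, h₁.right, sub_self, h₂.left]
    · rfl
  have hkey : ∀ s ∈ Icc 0 (L₁ + L₂), ∀ t ∈ Icc 0 (L₁ + L₂), s ≤ t →
      dist (if s ≤ L₁ then g₁ s else g₂ (s - L₁)) (if t ≤ L₁ then g₁ t else g₂ (t - L₁)) ≤
        t - s := by
    intro s hs t ht hst
    rcases le_total t L₁ with h | h
    · rw [if_pos (hst.trans h), if_pos h]
      have := h₁.dist_le (s := s) (t := t) ⟨hs.1, hst.trans h⟩ ⟨ht.1, h⟩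
      rwa [abs_sub_comm, abs_of_nonneg (sub_nonneg.2 hst)] at this
    rw [hval t h]
    have ht' : t - L₁ ∈ Icc 0 L₂ := ⟨by linarith, by linarith [ht.2]⟩
    rcases le_total L₁ s with h' | h'
    · rw [hval s h']
      have := h₂.dist_le (s := s - L₁) ⟨by linarith, by linarith [hs.2]⟩ ht'
      rw [abs_sub_comm, abs_of_nonneg (by linarith)] at this
      linarith
    · rw [if_pos h']
      have h3 := h₁.dist_le ⟨hs.1, h'⟩ (right_mem_Icc.2 h₁.nonneg)
      rw [h₁.right, abs_sub_comm, abs_of_nonneg (sub_nonneg.2 h')] at h3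
      linarith [dist_triangle (g₁ s) y (g₂ (t - L₁)), h₂.dist_left_le ht']
  refine ⟨add_nonneg h₁.nonneg h₂.nonneg, ?_, ?_, ?_⟩
  · refine LipschitzOnWith.of_dist_le_mul fun s hs t ht => ?_
    rw [NNReal.coe_one, one_mul]
    rcases le_total s t with hst | hst
    · rw [dist_comm s t, Real.dist_eq, abs_of_nonneg (sub_nonneg.2 hst)]
      exact hkey s hs t ht hst
    · rw [dist_comm, Real.dist_eq, abs_of_nonneg (sub_nonneg.2 hst)]
      exact hkey t ht s hs hst
  · simpa [h₁.nonneg] using h₁.left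
  · rw [hval _ (le_add_of_nonneg_right h₂.nonneg), add_sub_cancel_left, h₂.right]

end LipschitzPaths

/-! ### Estimates for the quasihyperbolic distance -/

section Quasihyperbolic

variable {X : Type*} [MetricSpace X] {G : Set X} {g : ℝ → X} {L : ℝ} {x y z : X}

theorem boundaryDist_le_add (G : Set X) (x y : X) :
    boundaryDist G x ≤ boundaryDist G y + dist x y :=
  Metric.infDist_le_infDist_add_dist

theorem qhDist_le_lintegral (h : IsLipPath g L x y) (hG : MapsTo g (Icc 0 L) G) :
    qhDist G x y ≤ ∫⁻ t in Icc 0 L, (ENNReal.ofReal (boundaryDist G (g t)))⁻¹ := by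
  refine le_trans ?_ (h.lineIntegral_le fun z => (ENNReal.ofReal (boundaryDist G z))⁻¹)
  exact iInf_le_of_le g (iInf_le_of_le 0 (iInf_le_of_le L
    (iInf_le_of_le ⟨h.isCurve, h.curveLength_ne_top, hG⟩ le_rfl)))

theorem exists_isLipPath_of_qhDist_lt {r : ℝ≥0∞} (h : qhDist G x y < r) :
    ∃ (g : ℝ → X) (L : ℝ), IsLipPath g L x y ∧ MapsTo g (Icc 0 L) G ∧
      ∫⁻ t in Icc 0 L, (ENNReal.ofReal (boundaryDist G (g t)))⁻¹ < r := by
  simp only [qhDist, iInf_lt_iff] at h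
  obtain ⟨γ, a, b, ⟨hγ, hl, hG⟩, hr⟩ := h
  obtain ⟨h1, h2⟩ := hγ.isLipPath_arclengthParam hl
  exact ⟨_, _, h1, h2.mono_right hG.image_subset, hr⟩

theorem le_qhDist {r : ℝ≥0∞} (h : ∀ (g : ℝ → X) (L : ℝ), IsLipPath g L x y →
    MapsTo g (Icc 0 L) G → r ≤ ∫⁻ t in Icc 0 L, (ENNReal.ofReal (boundaryDist G (g t)))⁻¹) :
    r ≤ qhDist G x y := by
  by_contra! hlt
  obtain ⟨g, L, h1, h2, h3⟩ := exists_isLipPath_of_qhDist_lt hlt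
  exact absurd (h g L h1 h2) (not_le.2 h3)

theorem qhDist_triangle (G : Set X) (x y z : X) : qhDist G x z ≤ qhDist G x y + qhDist G y z := by
  refine le_of_forall_gt fun r hr => ?_
  obtain ⟨a, ha, b, hb, hab⟩ : ∃ a > qhDist G x y, ∃ b > qhDist G y z, a + b < r := by
    have h1 : qhDist G x y ≠ ∞ := fun h => by simp [h] at hr
    have h2 : qhDist G y z ≠ ∞ := fun h => by simp [h] at hr
    obtain ⟨ε, hε, hlt⟩ := ENNReal.exists_nnreal_pos_mul_lt (a := 2) (by simp)
      (tsub_pos_of_lt hr).ne'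
    have hε' : (ε : ℝ≥0∞) ≠ 0 := by exact_mod_cast hε.ne'
    refine ⟨qhDist G x y + ε, ENNReal.lt_add_right h1 hε', qhDist G y z + ε,
      ENNReal.lt_add_right h2 hε', ?_⟩
    calc qhDist G x y + ε + (qhDist G y z + ε)
        = qhDist G x y + qhDist G y z + ε * 2 := by ring
      _ < r := lt_tsub_iff_left.1 hlt
  obtain ⟨g₁, L₁, h₁, m₁, i₁⟩ := exists_isLipPath_of_qhDist_lt ha
  obtain ⟨g₂, L₂, h₂, m₂, i₂⟩ := exists_isLipPath_of_qhDist_lt hb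
  set g := fun t => if t ≤ L₁ then g₁ t else g₂ (t - L₁) with hg
  have hm : MapsTo g (Icc 0 (L₁ + L₂)) G := by
    intro t ht
    simp only [hg]
    split_ifs with h
    · exact m₁ ⟨ht.1, h⟩
    · exact m₂ ⟨by linarith, by linarith [ht.2]⟩
  refine lt_of_le_of_lt ((qhDist_le_lintegral (h₁.trans h₂) hm).trans ?_) hab
  have hunion : Icc 0 (L₁ + L₂) = Icc 0 L₁ ∪ Ioc L₁ (L₁ + L₂) :=
    (Icc_union_Ioc_eq_Icc h₁.nonneg (le_add_of_nonneg_right h₂.nonneg)).symm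
  rw [hunion]
  refine (lintegral_union_le _ _ _).trans (add_le_add (le_trans (le_of_eq ?_) i₁.le)
    (le_trans ?_ i₂.le))
  · refine setLIntegral_congr_fun measurableSet_Icc fun t ht => ?_
    simp [ht.2]
  · have : ∫⁻ t in Ioc L₁ (L₁ + L₂), (ENNReal.ofReal (boundaryDist G (g t)))⁻¹ =
        ∫⁻ t in Ioc L₁ (L₁ + L₂), (ENNReal.ofReal (boundaryDist G (g₂ (t - L₁))))⁻¹ := by
      refine setLIntegral_congr_fun measurableSet_Ioc fun t ht => ?_
      simp [hg, not_le.2 ht.1]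
    rw [this]
    have hpre : (fun t => t - L₁) ⁻¹' Icc 0 L₂ = Icc L₁ (L₁ + L₂) := by
      ext t
      simp only [mem_preimage, mem_Icc, sub_nonneg, sub_le_iff_le_add']
    have hmp := (measurePreserving_sub_right volume L₁).setLIntegral_comp_preimage_emb
      (measurableEmbedding_subRight L₁)
      (fun t => (ENNReal.ofReal (boundaryDist G (g₂ t)))⁻¹) (Icc 0 L₂)
    rw [hpre] at hmp
    rw [← hmp]
    exact lintegral_mono_set Ioc_subset_Icc_self

theorem qhDist_le_of_le_boundaryDist (h : IsLipPath g L x y) (hG : MapsTo g (Icc 0 L) G) {d : ℝ}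
    (hd : 0 < d) (hle : ∀ t ∈ Icc 0 L, d ≤ boundaryDist G (g t)) :
    qhDist G x y ≤ ENNReal.ofReal (L / d) := by
  refine (qhDist_le_lintegral h hG).trans ?_
  calc ∫⁻ t in Icc 0 L, (ENNReal.ofReal (boundaryDist G (g t)))⁻¹
      ≤ ∫⁻ _ in Icc 0 L, (ENNReal.ofReal d)⁻¹ :=
        setLIntegral_mono measurable_const fun t ht =>
          ENNReal.inv_le_inv.2 (ENNReal.ofReal_le_ofReal (hle t ht))
    _ = ENNReal.ofReal (L / d) := by
        rw [setLIntegral_const, Real.volume_Icc, sub_zero, mul_comm,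
          ENNReal.ofReal_div_of_pos hd, div_eq_mul_inv]

/-- Along a 1-Lipschitz path from `x` the boundary distance at time `t` is at most `δ_G(x) + t`;
integrate the reciprocal. -/
theorem log_le_qhDist (hx : 0 < boundaryDist G x) :
    ENNReal.ofReal (Real.log (1 + dist x y / boundaryDist G x)) ≤ qhDist G x y := by
  refine le_qhDist fun g L h _ => ?_
  set d := boundaryDist G x
  have hL := h.nonneg
  have h1 : Real.log (1 + dist x y / d) ≤ ∫ t in (0)..L, (d + t)⁻¹ := by
    rw [intervalIntegral.integral_comp_add_left (fun t => t⁻¹), add_zero,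
      integral_inv_of_pos hx (by positivity)]
    apply Real.log_le_log (by positivity)
    rw [add_div, div_self hx.ne']
    gcongr
    exact h.dist_endpoints_le
  have hcont : ContinuousOn (fun t : ℝ => (d + t)⁻¹) (Icc 0 L) := by
    refine ContinuousOn.inv₀ (by fun_prop) fun t ht => ?_
    have := ht.1
    positivity
  have h2 : ENNReal.ofReal (∫ t in (0)..L, (d + t)⁻¹) =
      ∫⁻ t in Icc 0 L, ENNReal.ofReal (d + t)⁻¹ := by
    rw [intervalIntegral.integral_of_le hL, ← integral_Icc_eq_integral_Ioc]
    refine ofReal_integral_eq_lintegral_ofReal (hcont.integrableOn_Icc) ?_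
    filter_upwards [ae_restrict_mem measurableSet_Icc] with t ht
    have := ht.1
    positivity
  refine (ENNReal.ofReal_le_ofReal h1).trans (h2.le.trans ?_)
  refine lintegral_mono_ae ?_
  filter_upwards [ae_restrict_mem measurableSet_Icc] with t ht
  have h0 := ht.1
  rw [ENNReal.ofReal_inv_of_pos (by positivity)]
  refine ENNReal.inv_le_inv.2 (ENNReal.ofReal_le_ofReal ?_)
  have h3 := boundaryDist_le_add G (g t) x
  rw [dist_comm] at h3
  exact h3.trans (by gcongr; exact h.dist_left_le ht)

theorem dist_le_of_qhDist_le {t : ℝ} (hx : 0 < boundaryDist G x) (ht : 0 ≤ t)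
    (h : qhDist G x y ≤ ENNReal.ofReal t) : dist x y ≤ (Real.exp t - 1) * boundaryDist G x := by
  have h1 := (ENNReal.ofReal_le_ofReal_iff ht).1 ((log_le_qhDist hx).trans h)
  have h2 := (Real.log_le_iff_le_exp (by positivity)).1 h1
  rw [← div_le_iff₀ hx]
  linarith

theorem IsPreconnected.subset_of_disjoint_frontier {X : Type*} [TopologicalSpace X] {S G : Set X}
    (hS : IsPreconnected S) (hG : IsOpen G) (hx : (S ∩ G).Nonempty)
    (hd : ∀ w ∈ S, w ∉ frontier G) : S ⊆ G := by
  refine hS.subset_left_of_subset_union (v := (closure G)ᶜ) hG isClosed_closure.isOpen_compl ?_ ?_ hx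
  · exact (disjoint_compl_right (a := closure G)).mono_left subset_closure
  · intro w hw
    by_contra! hcon
    rw [mem_union, not_or, mem_compl_iff, not_not] at hcon
    exact hd w hw ⟨hcon.2, by rw [hG.interior_eq]; exact hcon.1⟩

theorem IsLipPath.isPreconnected_image (h : IsLipPath g L x y) : IsPreconnected (g '' Icc 0 L) :=
  isPreconnected_Icc.image _ h.lip.continuousOn

theorem IsLipPath.mapsTo_of_boundaryDist_pos (h : IsLipPath g L x y) (hG : IsOpen G) (hx : x ∈ G)
    (hpos : ∀ t ∈ Icc 0 L, 0 < boundaryDist G (g t)) : MapsTo g (Icc 0 L) G := by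
  rw [mapsTo_iff_image_subset]
  refine h.isPreconnected_image.subset_of_disjoint_frontier hG
    ⟨x, ⟨0, left_mem_Icc.2 h.nonneg, h.left⟩, hx⟩ ?_
  rintro _ ⟨t, ht, rfl⟩ hf
  have := hpos t ht
  rw [boundaryDist, Metric.infDist_zero_of_mem hf] at this
  exact this.false

theorem IsLipPath.sub_le_boundaryDist (h : IsLipPath g L x y) {t : ℝ} (ht : t ∈ Icc 0 L) :
    boundaryDist G x - L ≤ boundaryDist G (g t) := by
  linarith [boundaryDist_le_add G x (g t), h.dist_left_le ht, ht.2]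

theorem IsLipPath.mapsTo_of_lt_boundaryDist (h : IsLipPath g L x y) (hG : IsOpen G) (hx : x ∈ G)
    (hL : L < boundaryDist G x) : MapsTo g (Icc 0 L) G :=
  h.mapsTo_of_boundaryDist_pos hG hx fun _ ht =>
    (sub_pos.2 hL).trans_le (h.sub_le_boundaryDist ht)

/-- Connectedness of the space makes the frontier nonempty; with an empty frontier `Metric.infDist`
would be `0`. -/
theorem boundaryDist_pos [PreconnectedSpace X] (hG : IsOpen G) (hne : G ≠ univ) (hx : x ∈ G) :
    0 < boundaryDist G x := by
  have hf : (frontier G).Nonempty := nonempty_frontier_iff.2 ⟨⟨x, hx⟩, hne⟩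
  refine (isClosed_frontier.notMem_iff_infDist_pos hf).1 fun h => ?_
  have := hG.inter_frontier_eq
  exact (Set.eq_empty_iff_forall_notMem.1 this x) ⟨hx, h⟩

end Quasihyperbolic

/-! ### Consequences of quasiconvexity -/

section Quasiconvex

variable {X : Type*} [MetricSpace X] {c : ℝ} {G : Set X} {x y : X}

theorem IsQuasiconvexSpace.exists_isLipPath (h : IsQuasiconvexSpace c X) (x y : X) :
    ∃ (g : ℝ → X) (L : ℝ), IsLipPath g L x y ∧ L ≤ c * dist x y := by
  obtain ⟨γ, a, b, hγ, hl⟩ := h.2 x y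
  have hne : curveLength γ a b ≠ ∞ := ne_top_of_le_ne_top ENNReal.ofReal_ne_top hl
  refine ⟨_, _, (hγ.isLipPath_arclengthParam hne).1, ?_⟩
  exact ENNReal.toReal_le_of_le_ofReal (mul_nonneg (by linarith [h.1]) dist_nonneg) hl

theorem IsQuasiconvexSpace.preconnectedSpace (h : IsQuasiconvexSpace c X) :
    PreconnectedSpace X := by
  refine ⟨isPreconnected_of_forall_pair fun x _ y _ => ?_⟩
  obtain ⟨g, L, hg, _⟩ := h.exists_isLipPath x y
  exact ⟨g '' Icc 0 L, subset_univ _, ⟨0, left_mem_Icc.2 hg.nonneg, hg.left⟩,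
    ⟨L, right_mem_Icc.2 hg.nonneg, hg.right⟩, hg.isPreconnected_image⟩

theorem IsQuasiconvexSpace.locallyConnectedSpace (h : IsQuasiconvexSpace c X) :
    LocallyConnectedSpace X := by
  refine locallyConnectedSpace_iff_connected_subsets.2 fun x U hU => ?_
  obtain ⟨r, hr, hrU⟩ := Metric.mem_nhds_iff.1 hU
  have hc : 0 < c := by linarith [h.1]
  refine ⟨connectedComponentIn (Metric.ball x r) x, ?_, isPreconnected_connectedComponentIn,
    (connectedComponentIn_subset _ _).trans hrU⟩
  refine Filter.mem_of_superset (Metric.ball_mem_nhds x (div_pos hr hc)) fun y hy => ?_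
  obtain ⟨g, L, hg, hL⟩ := h.exists_isLipPath x y
  refine hg.isPreconnected_image.subset_connectedComponentIn
    ⟨0, left_mem_Icc.2 hg.nonneg, hg.left⟩ ?_ ⟨L, right_mem_Icc.2 hg.nonneg, hg.right⟩
  rintro _ ⟨t, ht, rfl⟩
  rw [Metric.mem_ball, dist_comm]
  rw [Metric.mem_ball, dist_comm, lt_div_iff₀ hc] at hy
  linarith [hg.dist_left_le ht, ht.2]

/-- A quasiconvexity path has length at most `δ_G(x) / 2`, so the boundary distance stays at least
`δ_G(x) / 2` along it. -/
theorem IsQuasiconvexSpace.qhDist_le (h : IsQuasiconvexSpace c X) (hG : IsOpen G) (hx : x ∈ G)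
    (hpos : 0 < boundaryDist G x) (hxy : dist x y ≤ boundaryDist G x / (2 * c)) :
    qhDist G x y ≤ ENNReal.ofReal (2 * c * (dist x y / boundaryDist G x)) := by
  have hc : 0 < c := by linarith [h.1]
  obtain ⟨g, L, hg, hL⟩ := h.exists_isLipPath x y
  rw [le_div_iff₀ (by positivity)] at hxy
  have hL2 : L ≤ boundaryDist G x / 2 := by linarith
  refine (qhDist_le_of_le_boundaryDist hg (hg.mapsTo_of_lt_boundaryDist hG hx (by linarith))
    (half_pos hpos) fun t ht => ?_).trans (ENNReal.ofReal_le_ofReal ?_)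
  · linarith [hg.sub_le_boundaryDist (G := G) ht]
  · rw [div_le_iff₀ (half_pos hpos)]
    calc L ≤ c * dist x y := hL
      _ = _ := by field_simp

end Quasiconvex

/-! ### Chaining weak quasisymmetry along a path -/

section Chains

variable {X Y : Type*} [MetricSpace X] [MetricSpace Y]

/-- If `f` satisfies a weak quasisymmetry condition with ratio `lam` on `S`, then distortion is
controlled along a path in `S` whose length is comparable to `dist x b`. -/
theorem IsLipPath.dist_image_le {S : Set X} {f : X → Y} {g : ℝ → X} {L lam H : ℝ} {x a b : X}
    (hH : 0 ≤ H)
    (hf : ∀ u ∈ S, ∀ v ∈ S, ∀ p ∈ S, dist u v ≤ lam * dist u p →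
      dist (f u) (f v) ≤ H * dist (f u) (f p))
    (hlam : 0 < lam) (hg : IsLipPath g L x a) (hS : MapsTo g (Icc 0 L) S) (hb : b ∈ S) {N : ℕ}
    (hN : L ≤ N * (lam * (dist x b / 2))) :
    dist (f x) (f a) ≤ (1 + H) ^ N * dist (f x) (f b) := by
  have hL := hg.nonneg
  rcases Nat.eq_zero_or_pos N with rfl | hNpos
  · have hL0 : L = 0 := le_antisymm (by simpa using hN) hL
    have : x = a := by rw [← hg.left, ← hg.right, hL0]
    simp [this]
  have hN' : (0 : ℝ) < N := by exact_mod_cast hNpos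
  have hxS : x ∈ S := by simpa [hg.left] using hS (left_mem_Icc.2 hL)
  have hstep : L / N ≤ lam * (dist x b / 2) := by rwa [div_le_iff₀' hN']
  have hmem : ∀ i : ℕ, i ≤ N → (i : ℝ) * (L / N) ∈ Icc 0 L := by
    intro i hi
    refine ⟨by positivity, ?_⟩
    calc (i : ℝ) * (L / N) ≤ N * (L / N) := by gcongr
      _ = L := by field_simp
  -- Both distances are carried through the induction: each point of the chain is at least `dist x b
  -- / 2` away from `x` or from `b`, and whichever is far serves as the comparison point for the
  -- next step.
  have key : ∀ i : ℕ, i ≤ N →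
      dist (f (g (i * (L / N)))) (f x) ≤ (1 + H) ^ i * dist (f x) (f b) ∧
      dist (f (g (i * (L / N)))) (f b) ≤ (1 + H) ^ i * dist (f x) (f b) := by
    intro i
    induction i with
    | zero => intro _; simp [hg.left]
    | succ i ih =>
      intro hi
      obtain ⟨h1, h2⟩ := ih (by omega)
      have hm := hmem i (by omega)
      have hm' := hmem (i + 1) hi
      set u := g (i * (L / N))
      set v := g ((i + 1 : ℕ) * (L / N))
      have huv : dist u v ≤ lam * (dist x b / 2) := by
        refine (hg.dist_le hm hm').trans (le_trans (le_of_eq ?_) hstep)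
        rw [abs_sub_comm, abs_of_nonneg]
        · push_cast; ring
        · push_cast
          have : 0 ≤ L / N := by positivity
          linarith
      have hfuv : dist (f u) (f v) ≤ H * ((1 + H) ^ i * dist (f x) (f b)) := by
        rcases le_total (dist x b / 2) (dist u x) with h | h
        · rw [dist_comm u x] at h
          refine (hf u (hS hm) v (hS hm') x hxS (huv.trans ?_)).trans (by gcongr)
          rw [dist_comm u x]; gcongr
        · refine (hf u (hS hm) v (hS hm') b hb (huv.trans ?_)).trans (by gcongr)
          have := dist_triangle x u b
          rw [dist_comm x u] at this
          gcongr
          linarith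
      rw [dist_comm] at hfuv
      rw [pow_succ]
      constructor
      · linarith [dist_triangle (f v) (f u) (f x)]
      · linarith [dist_triangle (f v) (f u) (f b)]
  have := (key N le_rfl).1
  rwa [mul_div_cancel₀ _ hN'.ne', hg.right, dist_comm] at this

end Chains

/-! ### Components of a punctured domain -/

section PuncturedComponents

variable {X : Type*} [MetricSpace X] {G : Set X} {u p : X}

theorem isOpen_connectedComponentIn_diff_singleton [LocallyConnectedSpace X] (hG : IsOpen G)
    (u p : X) : IsOpen (connectedComponentIn (G \ {p}) u) :=
  (hG.sdiff isClosed_singleton).connectedComponentIn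

/-- By local connectedness the component of a point of `G \ {p}` is open; if the point is a limit of
`D`, its component meets `D` and so equals `D`. -/
theorem frontier_connectedComponentIn_diff_singleton_subset [LocallyConnectedSpace X]
    (hG : IsOpen G) :
    frontier (connectedComponentIn (G \ {p}) u) ⊆ insert p (frontier G) := by
  intro w hw
  by_contra hcon
  rw [mem_insert_iff, not_or] at hcon
  set D := connectedComponentIn (G \ {p}) u with hD
  have hDo : IsOpen D := isOpen_connectedComponentIn_diff_singleton hG u p
  have hDG : D ⊆ G \ {p} := connectedComponentIn_subset _ _
  have hwG : w ∈ G := by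
    by_contra h
    refine hcon.2 ⟨closure_mono (hDG.trans sdiff_subset) hw.1, ?_⟩
    rwa [hG.interior_eq]
  have hwF : w ∈ G \ {p} := ⟨hwG, hcon.1⟩
  have hCo := isOpen_connectedComponentIn_diff_singleton hG w p
  obtain ⟨v, hv1, hv2⟩ := mem_closure_iff.1 hw.1 _ hCo (mem_connectedComponentIn hwF)
  have h1 := connectedComponentIn_eq hv1
  have h2 := connectedComponentIn_eq hv2
  have hwD : w ∈ D := by
    rw [hD, h2, ← h1]
    exact mem_connectedComponentIn hwF
  exact hw.2 (by rwa [hDo.interior_eq])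

/-- Otherwise the component would have no frontier point in `G`, and connectedness of `G` would
force it to contain `p`. -/
theorem mem_closure_connectedComponentIn_diff_singleton [LocallyConnectedSpace X]
    (hG : IsDomainSet G) (hu : u ∈ G) (hp : p ∈ G) (hup : u ≠ p) :
    p ∈ closure (connectedComponentIn (G \ {p}) u) := by
  by_contra hcl
  have huD : u ∈ connectedComponentIn (G \ {p}) u := mem_connectedComponentIn ⟨hu, hup⟩
  have hsub : G ⊆ connectedComponentIn (G \ {p}) u := by
    refine hG.2.isPreconnected.subset_of_disjoint_frontier
      (isOpen_connectedComponentIn_diff_singleton hG.1 u p) ⟨u, hu, huD⟩ fun w hw hf => ?_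
    rcases frontier_connectedComponentIn_diff_singleton_subset hG.1 hf with rfl | h
    · exact hcl hf.1
    · exact eq_empty_iff_forall_notMem.1 hG.1.inter_frontier_eq w ⟨hw, h⟩
  exact (connectedComponentIn_subset _ _ (hsub hp)).2 rfl

theorem le_boundaryDist_connectedComponentIn_diff_singleton [PreconnectedSpace X]
    [LocallyConnectedSpace X] (hG : IsOpen G) (hu : u ∈ G) (hup : u ≠ p) {w : X} {d : ℝ}
    (h1 : d ≤ boundaryDist G w) (h2 : d ≤ dist w p) :
    d ≤ boundaryDist (connectedComponentIn (G \ {p}) u) w := by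
  have hne : (frontier (connectedComponentIn (G \ {p}) u)).Nonempty := by
    refine nonempty_frontier_iff.2 ⟨⟨u, mem_connectedComponentIn ⟨hu, hup⟩⟩, fun h => ?_⟩
    exact (connectedComponentIn_subset (G \ {p}) u (h ▸ mem_univ p)).2 rfl
  refine (Metric.le_infDist hne).2 fun y hy => ?_
  rcases frontier_connectedComponentIn_diff_singleton_subset hG hy with rfl | h
  · exact h2
  · exact h1.trans (Metric.infDist_le_dist_of_mem h)

end PuncturedComponents

/-! ### Semisolid maps are locally weakly quasisymmetric -/

section SemisolidToQuasisymmetric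

variable {X Y : Type*} [MetricSpace X] [MetricSpace Y] {c c' : ℝ} {f : OpenPartialHomeomorph X Y}

/-- Semisolidity is applied in the component of `f.source \ {p}` containing `u`. There `f p` becomes
a boundary point of the image, so `|f u - f p|` bounds the boundary distance at `f u`. -/
theorem IsSemisolidInSubdomains.dist_le_exp_mul (hf : IsProperDomainHomeo c c' f) {φ : ℝ≥0 → ℝ≥0}
    (hφ : IsSemisolidInSubdomains φ f f.source) {M : ℝ≥0} (hM : ∀ t ≤ 1, φ t ≤ M) {u v p : X}
    (hu : u ∈ f.source) (hp : p ∈ f.source) (huv : dist u v ≤ 1 / (2 * c) * dist u p)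
    (hup : dist u p ≤ boundaryDist f.source u) :
    dist (f u) (f v) ≤ Real.exp M * dist (f u) (f p) := by
  rcases eq_or_ne u p with rfl | hne
  · have : u = v := dist_le_zero.1 (by simpa using huv)
    simp [this]
  have := hf.quasiconvex_left.preconnectedSpace
  have := hf.quasiconvex_left.locallyConnectedSpace
  have := hf.quasiconvex_right.preconnectedSpace
  have hc : 0 < c := by linarith [hf.quasiconvex_left.1]
  have hG := hf.source_domain.1
  have hr : 0 < dist u p := dist_pos.2 hne
  obtain ⟨g, L, hg, hL⟩ := hf.quasiconvex_left.exists_isLipPath u v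
  have hL2 : L ≤ dist u p / 2 := by
    refine hL.trans ((mul_le_mul_of_nonneg_left huv hc.le).trans (le_of_eq ?_))
    field_simp
  set D := connectedComponentIn (f.source \ {p}) u with hD
  have hDG : D ⊆ f.source \ {p} := connectedComponentIn_subset _ _
  have hDo : IsOpen D := isOpen_connectedComponentIn_diff_singleton hG.1 u p
  have huD : u ∈ D := mem_connectedComponentIn ⟨hu, hne⟩
  have hDdom : IsDomainSet D := ⟨hDo, ⟨u, huD⟩, isPreconnected_connectedComponentIn⟩
  have hgG : MapsTo g (Icc 0 L) f.source := hg.mapsTo_of_lt_boundaryDist hG.1 hu (by linarith)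
  have hgp : ∀ t ∈ Icc 0 L, dist u p / 2 ≤ dist (g t) p := fun t ht => by
    linarith [dist_triangle u (g t) p, hg.dist_left_le ht, ht.2]
  have hgD : MapsTo g (Icc 0 L) D := by
    rw [mapsTo_iff_image_subset]
    refine hg.isPreconnected_image.subset_connectedComponentIn
      ⟨0, left_mem_Icc.2 hg.nonneg, hg.left⟩ ?_
    rintro _ ⟨t, ht, rfl⟩
    exact ⟨hgG ht, dist_pos.1 ((half_pos hr).trans_le (hgp t ht))⟩
  have hk : qhDist D u v ≤ 1 := by
    refine (qhDist_le_of_le_boundaryDist hg hgD (half_pos hr) fun t ht => ?_).trans ?_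
    · refine le_boundaryDist_connectedComponentIn_diff_singleton hG.1 hu hne ?_ (hgp t ht)
      linarith [hg.sub_le_boundaryDist (G := f.source) ht]
    · rw [← ENNReal.ofReal_one]
      exact ENNReal.ofReal_le_ofReal ((div_le_one (half_pos hr)).2 hL2)
  obtain ⟨t, ht⟩ : ∃ t : ℝ≥0, (t : ℝ≥0∞) = qhDist D u v :=
    ⟨_, ENNReal.coe_toNNReal (ne_top_of_le_ne_top ENNReal.one_ne_top hk)⟩
  have hvD : v ∈ D := by simpa [hg.right] using hgD (right_mem_Icc.2 hg.nonneg)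
  have ht1 : t ≤ 1 := by rw [← ht] at hk; exact_mod_cast hk
  have hk' : qhDist (f '' D) (f u) (f v) ≤ ENNReal.ofReal (M : ℝ) := by
    rw [ENNReal.ofReal_coe_nnreal]
    exact (hφ D (hDG.trans sdiff_subset) hDdom u huD v hvD t ht.symm).trans
      (by exact_mod_cast hM t ht1)
  have hDs : D ⊆ f.source := hDG.trans sdiff_subset
  have hfo : IsOpen (f '' D) := f.isOpen_image_of_subset_source hDo hDs
  have hfp : f p ∉ f '' D := by
    rintro ⟨w, hw, hwp⟩
    exact (hDG hw).2 (f.injOn (hDs hw) hp hwp)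
  have hpos : 0 < boundaryDist (f '' D) (f u) :=
    boundaryDist_pos hfo (fun h => hfp (h ▸ mem_univ _)) (mem_image_of_mem f huD)
  have hfr : f p ∈ frontier (f '' D) := by
    rw [hfo.frontier_eq]
    exact ⟨mem_closure_image (f.continuousAt hp)
      (mem_closure_connectedComponentIn_diff_singleton hG hu hp hne), hfp⟩
  have hδ : boundaryDist (f '' D) (f u) ≤ dist (f u) (f p) := Metric.infDist_le_dist_of_mem hfr
  refine (dist_le_of_qhDist_le hpos M.2 hk').trans ?_
  calc (Real.exp M - 1) * boundaryDist (f '' D) (f u)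
      ≤ (Real.exp M - 1) * dist (f u) (f p) := by
        apply mul_le_mul_of_nonneg_left hδ
        simp
    _ ≤ Real.exp M * dist (f u) (f p) := by gcongr; linarith

theorem exists_isLocallyWeaklyQuasisymmetric_of_bounded (c c' : ℝ) (M : ℝ≥0) :
    ∃ H q : ℝ, 1 ≤ H ∧ 0 < q ∧ q < 1 ∧
      ∀ (X : Type u) (Y : Type v) [MetricSpace X] [MetricSpace Y] (f : OpenPartialHomeomorph X Y)
        (φ : ℝ≥0 → ℝ≥0), (∀ t ≤ 1, φ t ≤ M) → IsProperDomainHomeo c c' f →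
          IsSemisolidInSubdomains φ f f.source →
          IsLocallyWeaklyQuasisymmetric q H f f.source := by
  -- For `c < 1` no space is `c`-quasiconvex, and any constants will do.
  by_cases hc1 : 1 ≤ c
  swap
  · exact ⟨1, 1 / 2, le_rfl, by norm_num, by norm_num,
      fun X Y _ _ f φ _ hf => absurd hf.quasiconvex_left.1 hc1⟩
  have hc : 0 < c := by linarith
  -- With `q = 1 / (16c)`, paths between points of the component ball have length at most `δ / 8`
  -- and stay within `3δ / 16` of `z`, where the puncturing estimate applies to all pairs. A path of
  -- length at most `c |x - b|` splits into `⌈4c²⌉` steps of size at most `|x - b| / (4c)`.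
  refine ⟨(1 + Real.exp M) ^ ⌈4 * c ^ 2⌉₊, 1 / (16 * c), ?_, by positivity, ?_, ?_⟩
  · exact one_le_pow₀ (by linarith [Real.exp_pos M])
  · rw [div_lt_one (by positivity)]; linarith
  intro X Y _ _ f φ hM hf hφ z hz x hx a ha b hb hab
  have := hf.quasiconvex_left.preconnectedSpace
  have hG := hf.source_domain.1.1
  have hδ := boundaryDist_pos hG hf.source_domain.2 hz
  set δ := boundaryDist f.source z
  have hsub : componentBall f.source z (1 / (16 * c) * δ) ⊆
      Metric.ball z (1 / (16 * c) * δ) ∩ f.source := connectedComponentIn_subset _ _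
  set r := 1 / (16 * c) * δ with hr
  have hrc : c * r = δ / 16 := by rw [hr]; field_simp
  have hr16 : r ≤ δ / 16 := by rw [← hrc]; nlinarith [show 0 < r by positivity]
  obtain ⟨hx1, hx2⟩ := hsub hx
  obtain ⟨ha1, ha2⟩ := hsub ha
  obtain ⟨hb1, hb2⟩ := hsub hb
  rw [Metric.mem_ball, dist_comm] at hx1 ha1 hb1
  have hxa : dist x a ≤ 2 * r := by
    have := dist_triangle x z a
    rw [dist_comm x z] at this
    linarith
  obtain ⟨g, L, hg, hL⟩ := hf.quasiconvex_left.exists_isLipPath x a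
  have hL8 : L ≤ δ / 8 := by nlinarith
  have hδx : δ - r ≤ boundaryDist f.source x := by
    linarith [boundaryDist_le_add f.source z x]
  refine hg.dist_image_le (S := {w | w ∈ f.source ∧ dist z w ≤ 3 * δ / 16}) (lam := 1 / (2 * c))
    (Real.exp_pos M).le ?_ (by positivity) ?_ ⟨hb2, by linarith⟩ ?_
  · rintro u ⟨hu, hzu⟩ v - p ⟨hp, hzp⟩ huv
    refine hφ.dist_le_exp_mul hf hM hu hp huv ?_
    have := dist_triangle u z p
    rw [dist_comm u z] at this
    linarith [boundaryDist_le_add f.source z u]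
  · intro t ht
    refine ⟨hg.mapsTo_of_lt_boundaryDist hG hx2 (by linarith) ht, ?_⟩
    linarith [dist_triangle z x (g t), hg.dist_left_le ht, ht.2]
  · calc L ≤ c * dist x b := hL.trans (by gcongr)
      _ = (4 * c ^ 2) * (1 / (2 * c) * (dist x b / 2)) := by field_simp; ring
      _ ≤ _ := by gcongr; exact Nat.le_ceil _

end SemisolidToQuasisymmetric

/-! ### Hölder decay of weakly quasisymmetric maps -/

section WeaklyQuasisymmetric

variable {X Y : Type*} [MetricSpace X] [MetricSpace Y] {c c' H r R : ℝ}
  {f : OpenPartialHomeomorph X Y} {x : X}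

/-- Preimages of a convergent sequence are Cauchy: if `|y n - y N| ≥ ε`, a chain from `y n` to `x`
bounds `|f (y n) - f x|` by a fixed multiple of `|f (y n) - f (y N)|`, which is small, whereas the
left side stays away from `0`. The condition `2cr < R` keeps the chain in the ball. -/
theorem isClosed_image_closedBall [CompleteSpace X] (hX : IsQuasiconvexSpace c X) (hH : 1 ≤ H)
    (hr : 0 ≤ r) (hrR : 2 * c * r < R) (hR : Metric.ball x R ⊆ f.source)
    (hf : IsWeaklyQuasisymmetricOn H f (Metric.ball x R)) :
    IsClosed (f '' Metric.closedBall x r) := by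
  have hc := hX.1
  have hrR' : r < R := by nlinarith
  have hcR : Metric.closedBall x r ⊆ Metric.ball x R := Metric.closedBall_subset_ball hrR'
  refine IsSeqClosed.isClosed fun η' η hη' hη => ?_
  choose y hy hfy using hη'
  have hxball : x ∈ Metric.closedBall x r := Metric.mem_closedBall_self hr
  rcases eq_or_ne (f x) η with heq | hne
  · exact ⟨x, hxball, heq⟩
  have hd : 0 < dist (f x) η := dist_pos.2 hne
  have hcauchy : CauchySeq y := by
    refine Metric.cauchySeq_iff'.2 fun ε hε => ?_
    set K := ⌈2 * (c * r) / ε⌉₊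
    have hK : (0 : ℝ) < (1 + H) ^ K := by positivity
    have h1 : ∀ᶠ n in Filter.atTop,
        dist (η' n) η < dist (f x) η / 2 / (1 + H) ^ K / 2 ∧ dist (η' n) η < dist (f x) η / 2 :=
      ((tendsto_iff_dist_tendsto_zero.1 hη).eventually_lt_const (by positivity)).and
        ((tendsto_iff_dist_tendsto_zero.1 hη).eventually_lt_const (by positivity))
    obtain ⟨N, hN⟩ := Filter.eventually_atTop.1 h1
    refine ⟨N, fun n hn => ?_⟩
    by_contra! hcon
    obtain ⟨g, L, hg, hL⟩ := hX.exists_isLipPath (y n) x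
    have hyn : dist (y n) x ≤ r := hy n
    have hLr : L ≤ c * r := hL.trans (by gcongr)
    have hchain := hg.dist_image_le (S := Metric.ball x R) (f := f) (lam := 1) (H := H)
      (b := y N) (N := K) (by linarith)
      (fun u hu v hv p hp h => hf u hu v hv p hp (by simpa using h)) one_pos
      (fun t ht => by
        rw [Metric.mem_ball, dist_comm]
        have h2 := hg.dist_left_le ht
        have h3 := dist_triangle x (y n) (g t)
        rw [dist_comm x (y n)] at h3
        nlinarith [ht.2]) (hcR (hy N)) (by
        calc L ≤ c * r := hLr
          _ = 2 * (c * r) / ε * (ε / 2) := by field_simp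
          _ ≤ K * (1 * (dist (y n) (y N) / 2)) := by
            rw [one_mul]
            gcongr
            exact Nat.le_ceil _)
    rw [hfy, hfy] at hchain
    have h2 : dist (η' n) (η' N) < dist (f x) η / 2 / (1 + H) ^ K := by
      have := dist_triangle_right (η' n) (η' N) η
      linarith [(hN n hn).1, (hN N le_rfl).1]
    rw [lt_div_iff₀' hK] at h2
    have h3 := dist_triangle_left (f x) η (η' n)
    linarith [(hN n hn).2]
  obtain ⟨y₀, hy₀⟩ := cauchySeq_tendsto_of_complete hcauchy
  have hy₀r : y₀ ∈ Metric.closedBall x r :=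
    Metric.isClosed_closedBall.mem_of_tendsto hy₀ (Filter.Eventually.of_forall hy)
  refine ⟨y₀, hy₀r, tendsto_nhds_unique ?_ hη⟩
  have := (f.continuousAt (hR (hcR hy₀r))).tendsto.comp hy₀
  refine this.congr fun n => hfy n

/-- The path meets the frontier of the open set `f '' Metric.ball x r`. Since the image of the
closed ball is closed, this frontier lies in the image of the sphere. -/
theorem IsLipPath.exists_eq_image_sphere [CompleteSpace X] (hX : IsQuasiconvexSpace c X)
    (hH : 1 ≤ H) (hr : 0 < r) (hrR : 2 * c * r < R) (hR : Metric.ball x R ⊆ f.source)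
    (hf : IsWeaklyQuasisymmetricOn H f (Metric.ball x R)) {β : ℝ → Y} {T : ℝ} {η : Y}
    (hβ : IsLipPath β T (f x) η) (hη : η ∉ f '' Metric.ball x r) :
    ∃ t ∈ Icc 0 T, ∃ p, dist p x = r ∧ β t = f p := by
  have hrR' : r < R := by nlinarith [hX.1]
  have hcl := isClosed_image_closedBall hX hH hr.le hrR hR hf
  have hop : IsOpen (f '' Metric.ball x r) := f.isOpen_image_of_subset_source Metric.isOpen_ball
    ((Metric.ball_subset_ball hrR'.le).trans hR)
  by_contra! hcon
  refine hη (hβ.isPreconnected_image.subset_of_disjoint_frontier hop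
    ⟨f x, ⟨0, left_mem_Icc.2 hβ.nonneg, hβ.left⟩, x, Metric.mem_ball_self hr, rfl⟩ ?_
    ⟨T, right_mem_Icc.2 hβ.nonneg, hβ.right⟩)
  rintro _ ⟨t, ht, rfl⟩ hfr
  rw [hop.frontier_eq] at hfr
  obtain ⟨p, hp, hpt⟩ := hcl.closure_subset_iff.2 (image_mono Metric.ball_subset_closedBall) hfr.1
  rcases (Metric.mem_closedBall.1 hp).lt_or_eq with h | h
  · exact hfr.2 ⟨p, h, hpt⟩
  · exact hcon t ht p h hpt.symm

/-- Cut `β` where it meets the image of the sphere of radius `r / 2`, at `f p₁`. The tail is at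
least `|f p₁ - f p|` long, and two uses of weak quasisymmetry bound this below by `|f x - f a| / H ^
2`; the head is treated by induction. -/
theorem IsLipPath.nat_mul_dist_image_le [CompleteSpace X] (hX : IsQuasiconvexSpace c X)
    (hH : 1 ≤ H) (hR : Metric.ball x R ⊆ f.source)
    (hf : IsWeaklyQuasisymmetricOn H f (Metric.ball x R)) (n : ℕ) {r : ℝ} (hr : 0 < r)
    (hrR : 2 * c * r < R) {β : ℝ → Y} {T : ℝ} {p a : X} (hp : dist p x = r)
    (hβ : IsLipPath β T (f x) (f p)) (ha : dist x a ≤ r / 2 ^ n) :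
    n * dist (f x) (f a) ≤ H ^ 2 * T := by
  have hc := hX.1
  induction n generalizing r β T p with
  | zero => simpa using mul_nonneg (sq_nonneg H) hβ.nonneg
  | succ n ih =>
    have hrR' : r < R := by nlinarith
    have hpR : p ∈ Metric.ball x R := by rw [Metric.mem_ball, hp]; exact hrR'
    have hxR : x ∈ Metric.ball x R := Metric.mem_ball_self (hr.trans hrR')
    have hnot : f p ∉ f '' Metric.ball x (r / 2) := by
      rintro ⟨w, hw, hwp⟩
      have hwR : w ∈ Metric.ball x R := Metric.ball_subset_ball (by linarith) hw
      rw [f.injOn (hR hwR) (hR hpR) hwp, Metric.mem_ball, hp] at hw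
      linarith
    obtain ⟨t, ht, p₁, hp₁, hβt⟩ := hβ.exists_eq_image_sphere hX hH (half_pos hr)
      (by nlinarith) hR hf hnot
    have hp₁R : p₁ ∈ Metric.ball x R := by rw [Metric.mem_ball, hp₁]; linarith
    have h1 := ih (half_pos hr) (by nlinarith) hp₁ (hβt ▸ hβ.take ht)
      (by rwa [pow_succ', ← div_div] at ha)
    have ha2 : dist x a ≤ r / 2 := by
      rw [pow_succ', ← div_div] at ha
      exact ha.trans (div_le_self (half_pos hr).le (one_le_pow₀ one_le_two))
    have haR : a ∈ Metric.ball x R := by rw [Metric.mem_ball, dist_comm]; linarith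
    have h2 : dist (f x) (f a) ≤ H * dist (f x) (f p₁) :=
      hf x hxR a haR p₁ hp₁R (by rwa [dist_comm x p₁, hp₁])
    have h3 : dist (f p₁) (f x) ≤ H * dist (f p₁) (f p) :=
      hf p₁ hp₁R x hxR p hpR (by
        have := dist_triangle p p₁ x
        rw [dist_comm p p₁] at this
        linarith)
    have h4 : dist (f p₁) (f p) ≤ T - t := by
      have := hβ.dist_le ht (right_mem_Icc.2 hβ.nonneg)
      rwa [hβt, hβ.right, abs_sub_comm, abs_of_nonneg (sub_nonneg.2 ht.2)] at this
    rw [dist_comm] at h3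
    have h5 : dist (f x) (f a) ≤ H ^ 2 * (T - t) :=
      calc dist (f x) (f a) ≤ H * (H * (T - t)) :=
            h2.trans (by gcongr; exact h3.trans (by gcongr))
        _ = _ := by ring
    push_cast
    linarith

/-- Crossing `n` layers costs `n |f x - f p₁| / H ^ 2`, but a path of length `c' |f x - f p|` is
available; the choice of `n` makes the image distance halve when the radius shrinks by `2 ^ n`. -/
theorem dist_image_le_div_two_pow [CompleteSpace X] (hX : IsQuasiconvexSpace c X)
    (hY : IsQuasiconvexSpace c' Y) (hH : 1 ≤ H) (hR : Metric.ball x R ⊆ f.source)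
    (hf : IsWeaklyQuasisymmetricOn H f (Metric.ball x R)) {n : ℕ} (hn : 2 * H ^ 2 * c' ≤ n)
    (k : ℕ) {r : ℝ} (hr : 0 < r) (hrR : 2 * c * r < R) {p a : X} (hp : dist p x = r)
    (ha : dist x a ≤ r / (2 ^ n) ^ k) :
    dist (f x) (f a) ≤ H / 2 ^ k * dist (f x) (f p) := by
  have hc := hX.1
  have hc' := hY.1
  have hn0 : (0 : ℝ) < n := by nlinarith
  induction k generalizing r p with
  | zero =>
    have hrR' : r < R := by nlinarith
    have ha' : dist x a ≤ r := by simpa using ha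
    simp only [pow_zero, div_one]
    refine hf x (Metric.mem_ball_self (hr.trans hrR')) a ?_ p ?_ (by rwa [dist_comm x p, hp])
    · rw [Metric.mem_ball, dist_comm]; linarith
    · rwa [Metric.mem_ball, hp]
  | succ k ih =>
    have hrR' : r < R := by nlinarith
    have hpR : p ∈ Metric.ball x R := by rw [Metric.mem_ball, hp]; exact hrR'
    have hlt : r / 2 ^ n < r := by
      refine div_lt_self hr (one_lt_pow₀ one_lt_two ?_)
      rintro rfl
      simp at hn0
    have hr' : 0 < r / 2 ^ n := by positivity
    have hrR2 : 2 * c * (r / 2 ^ n) < R := lt_trans (by gcongr) hrR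
    have hnot : f p ∉ f '' Metric.ball x (r / 2 ^ n) := by
      rintro ⟨w, hw, hwp⟩
      have hwR : w ∈ Metric.ball x R := Metric.ball_subset_ball (by linarith) hw
      rw [f.injOn (hR hwR) (hR hpR) hwp, Metric.mem_ball, hp] at hw
      linarith
    obtain ⟨β, T, hβ, hT⟩ := hY.exists_isLipPath (f x) (f p)
    -- The crossing also shows that the smaller sphere is nonempty.
    obtain ⟨-, -, p₁, hp₁, -⟩ := hβ.exists_eq_image_sphere hX hH hr' hrR2 hR hf hnot
    have h1 := ih hr' hrR2 hp₁ (by rwa [div_div, ← pow_succ'])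
    have h2 := hβ.nat_mul_dist_image_le hX hH hR hf n hr hrR hp
      (a := p₁) (by rw [dist_comm, hp₁])
    have h3 : dist (f x) (f p₁) ≤ dist (f x) (f p) / 2 := by
      refine le_of_mul_le_mul_left (h2.trans ?_) hn0
      calc H ^ 2 * T ≤ H ^ 2 * (c' * dist (f x) (f p)) := by gcongr
        _ = 2 * H ^ 2 * c' * (dist (f x) (f p) / 2) := by ring
        _ ≤ _ := by gcongr
    calc dist (f x) (f a) ≤ H / 2 ^ k * (dist (f x) (f p) / 2) := h1.trans (by gcongr)
      _ = _ := by rw [pow_succ]; field_simp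

/-- A path from `f x` to an almost nearest boundary point of `f '' D` must cross the image of the
sphere; the factor `2` is there because the nearest point need not exist. -/
theorem exists_dist_image_le_boundaryDist [CompleteSpace X] (hX : IsQuasiconvexSpace c X)
    (hY : IsQuasiconvexSpace c' Y) (hH : 1 ≤ H) {D : Set X} (hD : IsOpen D)
    (hDf : D ⊆ f.source) (hR : Metric.ball x R ⊆ D)
    (hf : IsWeaklyQuasisymmetricOn H f (Metric.ball x R)) (hr : 0 < r) (hrR : 2 * c * r < R)
    (hpos : 0 < boundaryDist (f '' D) (f x)) :
    ∃ p, dist p x = r ∧ dist (f x) (f p) ≤ 2 * c' * boundaryDist (f '' D) (f x) := by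
  have hc' := hY.1
  have hop : IsOpen (f '' D) := f.isOpen_image_of_subset_source hD hDf
  have hrR' : r < R := by nlinarith [hX.1]
  have hne : (frontier (f '' D)).Nonempty := by
    by_contra h
    rw [not_nonempty_iff_eq_empty] at h
    simp [boundaryDist, h] at hpos
  obtain ⟨η, hη, hlt⟩ := (Metric.infDist_lt_iff hne).1
    (show Metric.infDist (f x) (frontier (f '' D)) < 2 * boundaryDist (f '' D) (f x) by
      change boundaryDist (f '' D) (f x) < _; linarith)
  have hηD : η ∉ f '' D := fun h =>
    eq_empty_iff_forall_notMem.1 hop.inter_frontier_eq η ⟨h, hη⟩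
  obtain ⟨β, T, hβ, hT⟩ := hY.exists_isLipPath (f x) η
  obtain ⟨t, ht, p, hp, hβt⟩ := hβ.exists_eq_image_sphere hX hH hr hrR (hR.trans hDf) hf
    fun h => hηD (image_mono ((Metric.ball_subset_ball hrR'.le).trans hR) h)
  refine ⟨p, hp, ?_⟩
  rw [← hβt]
  calc dist (f x) (β t) ≤ T := (hβ.dist_left_le ht).trans ht.2
    _ ≤ c' * (2 * boundaryDist (f '' D) (f x)) := hT.trans (by gcongr)
    _ = _ := by ring

theorem dist_image_le_rpow_mul_boundaryDist [CompleteSpace X] (hX : IsQuasiconvexSpace c X)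
    (hY : IsQuasiconvexSpace c' Y) (hH : 1 ≤ H) {D : Set X} (hD : IsOpen D)
    (hDf : D ⊆ f.source) (hR : Metric.ball x R ⊆ D)
    (hf : IsWeaklyQuasisymmetricOn H f (Metric.ball x R)) {n : ℕ} (hn : 2 * H ^ 2 * c' ≤ n)
    (hr : 0 < r) (hrR : 2 * c * r < R) (hpos : 0 < boundaryDist (f '' D) (f x)) {a : X} {s : ℝ}
    (hs : 0 ≤ s) (hs1 : s ≤ 1) (ha : dist x a ≤ s * r) :
    dist (f x) (f a) ≤ 4 * c' * H * s ^ (1 / n : ℝ) * boundaryDist (f '' D) (f x) := by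
  have hc' := hY.1
  have hn0 : (0 : ℝ) < n := by nlinarith
  have hn0' : n ≠ 0 := by rintro rfl; simp at hn0
  rcases hs.eq_or_lt with rfl | hs0
  · have : x = a := dist_le_zero.1 (by simpa using ha)
    have hc0 : 0 < c' := by linarith
    rw [← this, dist_self]
    positivity
  -- Choose `k` with `2 ^ (-n(k+1)) < s ≤ 2 ^ (-nk)`; passing from `k` to `k + 1` costs the extra
  -- factor `2` in the constant.
  obtain ⟨k, hk1, hk2⟩ := exists_nat_pow_near_of_lt_one hs0 hs1
    (show (0 : ℝ) < (2 ^ n)⁻¹ by positivity)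
    (inv_lt_one_of_one_lt₀ (one_lt_pow₀ one_lt_two hn0'))
  obtain ⟨p, hp, hfp⟩ := exists_dist_image_le_boundaryDist hX hY hH hD hDf hR hf hr hrR hpos
  have h1 := dist_image_le_div_two_pow hX hY hH (hR.trans hDf) hf hn k hr hrR hp (a := a) (by
    refine ha.trans ?_
    rw [div_eq_inv_mul, ← inv_pow]
    gcongr)
  have h2 : ((2 : ℝ) ^ (k + 1))⁻¹ ≤ s ^ (1 / n : ℝ) := by
    have h3 : ((2 : ℝ) ^ (k + 1))⁻¹ = (((2 ^ n)⁻¹ : ℝ) ^ (k + 1)) ^ (1 / n : ℝ) := by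
      rw [inv_pow, ← pow_mul, mul_comm n, pow_mul, ← inv_pow _ n, one_div,
        Real.pow_rpow_inv_natCast (by positivity) hn0']
    rw [h3]
    gcongr
  calc dist (f x) (f a) ≤ H / 2 ^ k * (2 * c' * boundaryDist (f '' D) (f x)) :=
        h1.trans (by gcongr)
    _ = 4 * c' * H * ((2 : ℝ) ^ (k + 1))⁻¹ * boundaryDist (f '' D) (f x) := by
        rw [pow_succ]; field_simp; ring
    _ ≤ _ := by gcongr

end WeaklyQuasisymmetric

/-! ### Subdividing paths by quasihyperbolic length -/

section PathSubdivision

variable {X : Type*} [MetricSpace X] {D : Set X} {g : ℝ → X} {L : ℝ} {x y : X}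

theorem IsLipPath.continuousOn_inv_boundaryDist (hg : IsLipPath g L x y)
    (hpos : ∀ t ∈ Icc 0 L, 0 < boundaryDist D (g t)) :
    ContinuousOn (fun t => (boundaryDist D (g t))⁻¹) (Icc 0 L) :=
  ((Metric.continuous_infDist_pt _).comp_continuousOn hg.lip.continuousOn).inv₀
    fun t ht => (hpos t ht).ne'

theorem IsLipPath.lintegral_eq_ofReal (hg : IsLipPath g L x y)
    (hpos : ∀ t ∈ Icc 0 L, 0 < boundaryDist D (g t)) :
    ∫⁻ t in Icc 0 L, (ENNReal.ofReal (boundaryDist D (g t)))⁻¹ =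
      ENNReal.ofReal (∫ t in (0)..L, (boundaryDist D (g t))⁻¹) := by
  rw [intervalIntegral.integral_of_le hg.nonneg, ← integral_Icc_eq_integral_Ioc,
    ofReal_integral_eq_lintegral_ofReal (hg.continuousOn_inv_boundaryDist hpos).integrableOn_Icc]
  · refine setLIntegral_congr_fun measurableSet_Icc fun t ht => ?_
    rw [ENNReal.ofReal_inv_of_pos (hpos t ht)]
  · filter_upwards [ae_restrict_mem measurableSet_Icc] with t ht
    exact (inv_pos.2 (hpos t ht)).le

theorem IsLipPath.qhDist_sub_le (hg : IsLipPath g L x y) (hD : MapsTo g (Icc 0 L) D)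
    (hpos : ∀ t ∈ Icc 0 L, 0 < boundaryDist D (g t)) {s t : ℝ} (hs : 0 ≤ s) (hst : s ≤ t)
    (ht : t ≤ L) :
    qhDist D (g s) (g t) ≤ ENNReal.ofReal (∫ u in s..t, (boundaryDist D (g u))⁻¹) := by
  have hmem : ∀ u ∈ Icc 0 (t - s), u + s ∈ Icc 0 L := fun u hu =>
    ⟨by linarith [hu.1], by linarith [hu.2]⟩
  have hsub := hg.sub hs hst ht
  refine (qhDist_le_lintegral hsub fun u hu => hD (hmem u hu)).trans (le_of_eq ?_)
  rw [hsub.lintegral_eq_ofReal fun u hu => hpos _ (hmem u hu),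
    intervalIntegral.integral_comp_add_right (fun u => (boundaryDist D (g u))⁻¹)]
  simp

/-- A map between quasihyperbolic metrics which sends points at distance at most `τ` to points at
distance at most `1` sends points at distance less than `(n + 1) * τ` to points at distance at
most `n + 1`. -/
theorem qhDist_image_le_of_lt {Y : Type*} [MetricSpace Y] {f : X → Y}
    (hpos : ∀ z ∈ D, 0 < boundaryDist D z) {τ : ℝ} (hτ : 0 < τ)
    (hf : ∀ u ∈ D, ∀ v ∈ D, qhDist D u v ≤ ENNReal.ofReal τ →
      qhDist (f '' D) (f u) (f v) ≤ 1) (n : ℕ)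
    (hxy : qhDist D x y < ENNReal.ofReal ((n + 1) * τ)) :
    qhDist (f '' D) (f x) (f y) ≤ (n + 1 : ℕ) := by
  obtain ⟨g, L, hg, hD, hint⟩ := exists_isLipPath_of_qhDist_lt hxy
  have hpos' : ∀ t ∈ Icc 0 L, 0 < boundaryDist D (g t) := fun t ht => hpos _ (hD ht)
  rw [hg.lintegral_eq_ofReal hpos', ENNReal.ofReal_lt_ofReal_iff (by positivity)] at hint
  have hL := hg.nonneg
  have hcont := hg.continuousOn_inv_boundaryDist hpos'
  have hii : ∀ s ∈ Icc 0 L, ∀ t ∈ Icc 0 L,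
      IntervalIntegrable (fun u => (boundaryDist D (g u))⁻¹) volume s t := fun s hs t ht =>
    (hcont.mono (uIcc_subset_Icc hs ht)).intervalIntegrable
  have h0 : (0 : ℝ) ∈ Icc 0 L := left_mem_Icc.2 hL
  have hIcont : ContinuousOn (fun s => ∫ u in (0)..s, (boundaryDist D (g u))⁻¹) (Icc 0 L) := by
    have := intervalIntegral.continuousOn_primitive_interval (μ := volume)
      (f := fun u => (boundaryDist D (g u))⁻¹) (a := 0) (b := L)
      (by rw [uIcc_of_le hL]; exact hcont.integrableOn_Icc)
    rwa [uIcc_of_le hL] at this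
  have key : ∀ m : ℕ, ∀ s ∈ Icc 0 L,
      ∫ u in (0)..s, (boundaryDist D (g u))⁻¹ ≤ (m + 1) * τ →
        qhDist (f '' D) (f x) (f (g s)) ≤ (m + 1 : ℕ) := by
    intro m
    induction m with
    | zero =>
      intro s hs hle
      have := hg.qhDist_sub_le hD hpos' le_rfl hs.1 hs.2
      rw [hg.left] at this
      have hxD : x ∈ D := by simpa [hg.left] using hD h0
      simpa using hf x hxD _ (hD hs) (this.trans (ENNReal.ofReal_le_ofReal (by simpa using hle)))
    | succ m ih =>
      intro s hs hle
      rcases le_total (∫ u in (0)..s, (boundaryDist D (g u))⁻¹) ((m + 1) * τ) with h | h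
      · exact (ih s hs h).trans (by push_cast; exact le_self_add)
      -- Cut where the accumulated quasihyperbolic length equals `(m + 1) * τ`, leaving a last piece
      -- of length at most `τ`.
      · obtain ⟨s', hs', hval⟩ := intermediate_value_Icc hs.1
          (hIcont.mono (Icc_subset_Icc_right hs.2))
          (show ((m : ℝ) + 1) * τ ∈ _ from ⟨by simp; positivity, h⟩)
        have hs'L : s' ∈ Icc 0 L := ⟨hs'.1, hs'.2.trans hs.2⟩
        have hadd := intervalIntegral.integral_add_adjacent_intervals (hii 0 h0 s' hs'L)
          (hii s' hs'L s hs)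
        have h1 := ih s' hs'L hval.le
        have h2 := hf _ (hD hs'L) _ (hD hs)
          ((hg.qhDist_sub_le hD hpos' hs'.1 hs'.2 hs.2).trans (ENNReal.ofReal_le_ofReal (by
            simp only at hval
            push_cast at hle
            linarith)))
        refine (qhDist_triangle _ _ (f (g s')) _).trans ((add_le_add h1 h2).trans ?_)
        push_cast
        exact le_rfl
  have := key n L (right_mem_Icc.2 hL) hint.le
  rwa [hg.right] at this

end PathSubdivision

/-! ### The small-scale Hölder bound in subdomains -/

section QuasisymmetricToSemisolid

variable {X Y : Type*} [MetricSpace X] [MetricSpace Y] {c c' H q : ℝ}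
  {f : OpenPartialHomeomorph X Y} {D : Set X} {x : X}

/-- A path from `x` to a frontier point of `G` has to leave `D`, so its length is at least `δ_D(x)`.
The factor `c` compares this length with the distance. -/
theorem boundaryDist_subdomain_le (hX : IsQuasiconvexSpace c X) {G : Set X} (hG : IsOpen G)
    (hne : G ≠ univ) (hD : IsOpen D) (hDG : D ⊆ G) (hx : x ∈ D) :
    boundaryDist D x ≤ c * boundaryDist G x := by
  have := hX.preconnectedSpace
  have hc : 0 < c := by linarith [hX.1]
  have hf : (frontier G).Nonempty := nonempty_frontier_iff.2 ⟨⟨x, hDG hx⟩, hne⟩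
  rw [← div_le_iff₀' hc]
  refine (Metric.le_infDist hf).2 fun p hp => ?_
  obtain ⟨g, L, hg, hL⟩ := hX.exists_isLipPath x p
  rw [div_le_iff₀' hc]
  refine le_trans ?_ hL
  by_contra! hlt
  have h1 := hg.mapsTo_of_lt_boundaryDist hD hx hlt (right_mem_Icc.2 hg.nonneg)
  rw [hg.right] at h1
  exact eq_empty_iff_forall_notMem.1 hG.inter_frontier_eq p ⟨hDG h1, hp⟩

/-- Of the two factors `c` in the radius, one pays for joining points to `x` by paths and the other
for `δ_D ≤ c δ_G`. -/
theorem IsLocallyWeaklyQuasisymmetric.on_ball (hf : IsProperDomainHomeo c c' f)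
    (hq : 0 < q) (hq1 : q < 1) (h : IsLocallyWeaklyQuasisymmetric q H f f.source)
    (hD : IsOpen D) (hDf : D ⊆ f.source) (hx : x ∈ D) :
    Metric.ball x (q / c ^ 2 * boundaryDist D x) ⊆ D ∧
      IsWeaklyQuasisymmetricOn H f (Metric.ball x (q / c ^ 2 * boundaryDist D x)) := by
  have hX := hf.quasiconvex_left
  have := hX.preconnectedSpace
  have hc1 := hX.1
  have hc : 0 < c := by linarith
  have hpos : 0 < boundaryDist D x := boundaryDist_pos hD
    (fun h => hf.source_domain.2 (univ_subset_iff.1 (h ▸ hDf))) hx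
  have hle := boundaryDist_subdomain_le hX hf.source_domain.1.1 hf.source_domain.2 hD hDf hx
  have hpath : ∀ w ∈ Metric.ball x (q / c ^ 2 * boundaryDist D x), ∃ (g : ℝ → X) (L : ℝ),
      IsLipPath g L x w ∧ L < q * boundaryDist f.source x ∧ L < boundaryDist D x := by
    intro w hw
    obtain ⟨g, L, hg, hL⟩ := hX.exists_isLipPath x w
    rw [Metric.mem_ball, dist_comm] at hw
    have h1 : L < q / c * boundaryDist D x :=
      calc L ≤ c * dist x w := hL
        _ < c * (q / c ^ 2 * boundaryDist D x) := by gcongr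
        _ = q / c * boundaryDist D x := by field_simp
    refine ⟨g, L, hg, h1.trans_le ?_, h1.trans ?_⟩
    · calc q / c * boundaryDist D x ≤ q / c * (c * boundaryDist f.source x) := by gcongr
        _ = _ := by field_simp
    · refine mul_lt_of_lt_one_left hpos ?_
      rw [div_lt_one hc]; linarith
  constructor
  · intro w hw
    obtain ⟨g, L, hg, -, hL⟩ := hpath w hw
    simpa [hg.right] using hg.mapsTo_of_lt_boundaryDist hD hx hL (right_mem_Icc.2 hg.nonneg)
  · have hsub : Metric.ball x (q / c ^ 2 * boundaryDist D x) ⊆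
        componentBall f.source x (q * boundaryDist f.source x) := by
      intro w hw
      obtain ⟨g, L, hg, hL, hL'⟩ := hpath w hw
      refine hg.isPreconnected_image.subset_connectedComponentIn
        ⟨0, left_mem_Icc.2 hg.nonneg, hg.left⟩ ?_ ⟨L, right_mem_Icc.2 hg.nonneg, hg.right⟩
      rintro _ ⟨t, ht, rfl⟩
      refine ⟨?_, hDf (hg.mapsTo_of_lt_boundaryDist hD hx hL' ht)⟩
      rw [Metric.mem_ball, dist_comm]
      exact ((hg.dist_left_le ht).trans ht.2).trans_lt hL
    exact fun u hu a ha b hb => h x (hDf hx) u (hsub hu) a (hsub ha) b (hsub hb)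

/-- Small-scale Hölder estimate for the quasihyperbolic metrics of a subdomain and its image. -/
theorem IsLocallyWeaklyQuasisymmetric.qhDist_image_le (hf : IsProperDomainHomeo c c' f)
    (hH : 1 ≤ H) (hq : 0 < q) (hq1 : q < 1) (h : IsLocallyWeaklyQuasisymmetric q H f f.source)
    (hD : IsOpen D) (hDf : D ⊆ f.source) (hx : x ∈ D) {n : ℕ} (hn : 2 * H ^ 2 * c' ≤ n)
    {y : X} {t : ℝ} (ht0 : 0 ≤ t) (ht : 8 * c ^ 3 / q * t ≤ ((8 * c' ^ 2 * H) ^ n)⁻¹)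
    (hxy : qhDist D x y ≤ ENNReal.ofReal t) :
    qhDist (f '' D) (f x) (f y) ≤
      ENNReal.ofReal (8 * c' ^ 2 * H * (8 * c ^ 3 / q * t) ^ (1 / n : ℝ)) := by
  have hX := hf.quasiconvex_left
  have hY := hf.quasiconvex_right
  have := hf.complete_left
  have := hX.preconnectedSpace
  have := hY.preconnectedSpace
  have hc := hX.1
  have hc' := hY.1
  have hn0 : n ≠ 0 := by
    rintro rfl
    have : 0 < 2 * H ^ 2 * c' := by positivity
    simp at hn
    linarith
  have hpos : 0 < boundaryDist D x := boundaryDist_pos hD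
    (fun h => hf.source_domain.2 (univ_subset_iff.1 (h ▸ hDf))) hx
  have hop : IsOpen (f '' D) := f.isOpen_image_of_subset_source hD hDf
  have hpos' : 0 < boundaryDist (f '' D) (f x) := boundaryDist_pos hop
    (fun h => hf.target_domain.2 (univ_subset_iff.1 (h ▸ (f.mapsTo.mono_left hDf).image_subset)))
    (mem_image_of_mem f hx)
  obtain ⟨hball, hqs⟩ := h.on_ball hf hq hq1 hD hDf hx
  -- `K` is `2c'`, from `IsQuasiconvexSpace.qhDist_le`, times the Hölder constant `4c'H`. The
  -- threshold `s ≤ K ^ (-n)` makes the image distance at most `δ / (2c')`, as that lemma demands.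
  set K := 8 * c' ^ 2 * H with hK
  have hK1 : 1 ≤ K := by nlinarith
  set s := 8 * c ^ 3 / q * t with hs
  have hs0 : 0 ≤ s := by positivity
  have hs1 : s ≤ 1 := ht.trans (inv_le_one_of_one_le₀ (one_le_pow₀ hK1))
  have ht1 : t ≤ 1 := by
    have h8 : 1 ≤ 8 * c ^ 3 / q := by
      rw [one_le_div hq]
      have : 1 ≤ c ^ 3 := one_le_pow₀ hc
      linarith
    nlinarith
  have hdist : dist x y ≤ 2 * t * boundaryDist D x := by
    refine (dist_le_of_qhDist_le hpos ht0 hxy).trans ?_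
    gcongr
    have := Real.abs_exp_sub_one_le (x := t) (by rwa [abs_of_nonneg ht0])
    rw [abs_of_nonneg ht0] at this
    exact (le_abs_self _).trans this
  -- This `r` satisfies `2cr = R / 2 < R` and `s * r = 2 * t * δ_D(x)`, which explains the factor
  -- `8c³ / q`.
  have hmain := dist_image_le_rpow_mul_boundaryDist hX hY hH hD hDf hball hqs hn
    (r := q / c ^ 2 * boundaryDist D x / (4 * c)) (by positivity) (by
      have : 0 < q / c ^ 2 * boundaryDist D x := by positivity
      rw [mul_div_assoc', div_lt_iff₀ (by positivity)]
      nlinarith) hpos' hs0 hs1 (a := y) (by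
      refine hdist.trans (le_of_eq ?_)
      rw [hs]
      field_simp
      ring)
  have hspow : s ^ (1 / n : ℝ) ≤ K⁻¹ := by
    have : K⁻¹ = ((K ^ n)⁻¹ : ℝ) ^ (1 / n : ℝ) := by
      rw [← inv_pow, one_div, Real.pow_rpow_inv_natCast (by positivity) hn0]
    rw [this]
    gcongr
  have hratio : dist (f x) (f y) / boundaryDist (f '' D) (f x) ≤
      4 * c' * H * s ^ (1 / n : ℝ) := (div_le_iff₀ hpos').2 hmain
  refine (hY.qhDist_le hop (mem_image_of_mem f hx) hpos' ?_).trans (ENNReal.ofReal_le_ofReal ?_)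
  · calc dist (f x) (f y) ≤ 4 * c' * H * K⁻¹ * boundaryDist (f '' D) (f x) :=
          hmain.trans (by gcongr)
      _ = _ := by rw [hK]; field_simp; norm_num
  · calc 2 * c' * (dist (f x) (f y) / boundaryDist (f '' D) (f x))
        ≤ 2 * c' * (4 * c' * H * s ^ (1 / n : ℝ)) := by gcongr
      _ = K * s ^ (1 / n : ℝ) := by rw [hK]; ring

end QuasisymmetricToSemisolid

/-! ### Explicit control functions and the equivalence -/

section Equivalence

theorem exists_isSemisolidInSubdomains_powerControl (c c' H q : ℝ) (hH : 1 ≤ H) (hq : 0 < q)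
    (hq1 : q < 1) :
    ∃ (μ : ℝ≥0) (α : ℝ), 0 < μ ∧ 0 < α ∧ α < 1 ∧
      ∀ (X : Type u) (Y : Type v) [MetricSpace X] [MetricSpace Y] (f : OpenPartialHomeomorph X Y),
        IsProperDomainHomeo c c' f → IsLocallyWeaklyQuasisymmetric q H f f.source →
          IsSemisolidInSubdomains (powerControl μ α) f f.source := by
  by_cases hcc : 1 ≤ c ∧ 1 ≤ c'
  swap
  · exact ⟨1, 1 / 2, one_pos, by norm_num, by norm_num,
      fun X Y _ _ f hf => absurd ⟨hf.quasiconvex_left.1, hf.quasiconvex_right.1⟩ hcc⟩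
  obtain ⟨hc, hc'⟩ := hcc
  -- The summand `2` ensures that the exponent `1 / n` is less than `1`.
  set n := ⌈2 * H ^ 2 * c'⌉₊ + 2 with hn
  have hn0 : n ≠ 0 := by omega
  have hn2 : (2 : ℝ) ≤ n := by exact_mod_cast (by omega : 2 ≤ n)
  have hnH : 2 * H ^ 2 * c' ≤ n := by
    rw [hn]
    push_cast
    linarith [Nat.le_ceil (2 * H ^ 2 * c')]
  set A := 8 * c ^ 3 / q with hA
  set K := 8 * c' ^ 2 * H with hK
  have hA0 : 0 < A := by positivity
  have hK0 : 0 < K := by positivity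
  -- At `t = τ` the Hölder bound `K * (A * t) ^ (1 / n)` equals exactly `1`.
  set τ := (K ^ n)⁻¹ / A
  have hτ : 0 < τ := by positivity
  have hAτ : A * τ = (K ^ n)⁻¹ := mul_div_cancel₀ _ hA0.ne'
  -- The first entry serves `t ≤ τ`. For `t > τ` the number of pieces is `⌈t / τ⌉ + 1 ≤ t / τ + 2 ≤
  -- 3t / τ`.
  set μ := max (K * A ^ (1 / n : ℝ)) (3 / τ)
  have hμ : 0 < μ := lt_max_of_lt_right (by positivity)
  have hα : (0 : ℝ) < 1 / n := by positivity
  refine ⟨μ.toNNReal, 1 / n, Real.toNNReal_pos.2 hμ, hα, ?_, ?_⟩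
  · rw [div_lt_one (by linarith)]; linarith
  intro X Y _ _ f hf hqs D hDf hD x hx y hy t ht
  have := hf.quasiconvex_left.preconnectedSpace
  have hsmall : ∀ u ∈ D, ∀ v ∈ D, ∀ s : ℝ, 0 ≤ s → s ≤ τ → qhDist D u v ≤ ENNReal.ofReal s →
      qhDist (f '' D) (f u) (f v) ≤ ENNReal.ofReal (K * (A * s) ^ (1 / n : ℝ)) :=
    fun u hu v _ s hs hsτ h => hqs.qhDist_image_le hf hH hq hq1 hD.1 hDf hu hnH hs
      (by rw [← hA, ← hK, ← hAτ]; gcongr) h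
  have hstep : ∀ u ∈ D, ∀ v ∈ D, qhDist D u v ≤ ENNReal.ofReal τ →
      qhDist (f '' D) (f u) (f v) ≤ 1 := fun u hu v hv h => by
    refine (hsmall u hu v hv τ hτ.le le_rfl h).trans (le_of_eq ?_)
    rw [hAτ, ← inv_pow, one_div, Real.pow_rpow_inv_natCast (by positivity) hn0,
      mul_inv_cancel₀ hK0.ne', ENNReal.ofReal_one]
  have hcoe : ((powerControl μ.toNNReal (1 / n) t : ℝ≥0) : ℝ) =
      μ * max ((t : ℝ) ^ (1 / n : ℝ)) t := by
    simp [powerControl, hμ.le]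
  have ht' : qhDist D x y = ENNReal.ofReal (t : ℝ) := by rw [ht, ENNReal.ofReal_coe_nnreal]
  rw [← ENNReal.ofReal_coe_nnreal, hcoe]
  rcases le_or_gt (t : ℝ) τ with htτ | htτ
  · refine (hsmall x hx y hy t t.2 htτ ht'.le).trans (ENNReal.ofReal_le_ofReal ?_)
    rw [Real.mul_rpow hA0.le t.coe_nonneg, ← mul_assoc]
    gcongr
    · exact le_max_left _ _
    · exact le_max_left _ _
  · have hpos : ∀ z ∈ D, 0 < boundaryDist D z := fun z hz => boundaryDist_pos hD.1
      (fun h => hf.source_domain.2 (univ_subset_iff.1 (h ▸ hDf))) hz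
    have hlt : qhDist D x y < ENNReal.ofReal ((⌈(t : ℝ) / τ⌉₊ + 1) * τ) := by
      rw [ht', ENNReal.ofReal_lt_ofReal_iff (by positivity), ← div_lt_iff₀ hτ]
      linarith [Nat.le_ceil ((t : ℝ) / τ)]
    refine (qhDist_image_le_of_lt hpos hτ hstep _ hlt).trans ?_
    rw [← ENNReal.ofReal_natCast]
    refine ENNReal.ofReal_le_ofReal ?_
    have h1 : 1 ≤ (t : ℝ) / τ := (one_le_div hτ).2 htτ.le
    have h2 := Nat.ceil_lt_add_one (div_nonneg t.coe_nonneg hτ.le)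
    calc ((⌈(t : ℝ) / τ⌉₊ + 1 : ℕ) : ℝ) ≤ 3 * ((t : ℝ) / τ) := by
          push_cast
          linarith
      _ = 3 / τ * t := by ring
      _ ≤ _ := by
        gcongr
        · exact le_max_right _ _
        · exact le_max_right _ _

theorem powerControl_strictMono {μ : ℝ≥0} {α : ℝ} (hμ : 0 < μ) (hα : 0 < α) :
    StrictMono (powerControl μ α) := fun _ _ h =>
  mul_lt_mul_of_pos_left (max_lt_max (NNReal.rpow_lt_rpow h hα) h) hμ

theorem powerControl_surjective {μ : ℝ≥0} {α : ℝ} (hμ : 0 < μ) (hα : 0 < α) (hα1 : α < 1) :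
    Function.Surjective (powerControl μ α) := by
  intro s
  rcases le_total (s / μ) 1 with h | h
  · refine ⟨(s / μ) ^ (1 / α), ?_⟩
    rw [powerControl, one_div, NNReal.rpow_inv_rpow hα.ne',
      max_eq_left (NNReal.rpow_le_self_of_le_one h ((one_le_inv₀ hα).2 hα1.le)),
      mul_div_cancel₀ _ hμ.ne']
  · refine ⟨s / μ, ?_⟩
    have : (s / μ) ^ α ≤ s / μ := by
      simpa using NNReal.rpow_le_rpow_of_exponent_le h hα1.le
    rw [powerControl, max_eq_right this, mul_div_cancel₀ _ hμ.ne']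

theorem exists_homeomorph_eq_powerControl {μ : ℝ≥0} {α : ℝ} (hμ : 0 < μ) (hα : 0 < α)
    (hα1 : α < 1) : ∃ φ : ℝ≥0 ≃ₜ ℝ≥0, ⇑φ = powerControl μ α :=
  ⟨((powerControl_strictMono hμ hα).orderIsoOfSurjective _
    (powerControl_surjective hμ hα hα1)).toHomeomorph, rfl⟩

/-- Only an upper bound of `φ` on `[0, 1]` enters, and continuity supplies it. -/
theorem exists_isLocallyWeaklyQuasisymmetric (c c' : ℝ) (φ : ℝ≥0 ≃ₜ ℝ≥0) :
    ∃ H q : ℝ, 1 ≤ H ∧ 0 < q ∧ q < 1 ∧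
      ∀ (X : Type u) (Y : Type v) [MetricSpace X] [MetricSpace Y] (f : OpenPartialHomeomorph X Y),
        IsProperDomainHomeo c c' f → IsSemisolidInSubdomains φ f f.source →
          IsLocallyWeaklyQuasisymmetric q H f f.source := by
  obtain ⟨M, hM⟩ := (isCompact_Icc (a := (0 : ℝ≥0)) (b := 1)).bddAbove_image
    φ.continuous.continuousOn
  obtain ⟨H, q, hH, hq, hq1, h⟩ := exists_isLocallyWeaklyQuasisymmetric_of_bounded.{u, v} c c' M
  exact ⟨H, q, hH, hq, hq1, fun X Y _ _ f =>
    h X Y f φ fun t ht => hM ⟨t, ⟨zero_le, ht⟩, rfl⟩⟩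

end Equivalence

/-- For every homeomorphism between proper domains the three conditions are equivalent, and each of
them yields the two others with data (`φ`; `μ`, `α`; `H`, `q`) that depend only on its own data and
on `c`, `c'`, but not on the spaces, the domains or the map. -/
theorem theorem1p1 (c c' : ℝ) :
    -- the equivalence of the three conditions
    (∀ (X : Type u) (Y : Type v) [MetricSpace X] [MetricSpace Y] (f : OpenPartialHomeomorph X Y),
      IsProperDomainHomeo c c' f →
      List.TFAE [
        ∃ φ : ℝ≥0 ≃ₜ ℝ≥0, IsSemisolidInSubdomains φ f f.source,
        ∃ (μ : ℝ≥0) (α : ℝ), 0 < μ ∧ 0 < α ∧ α < 1 ∧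
          IsSemisolidInSubdomains (powerControl μ α) f f.source,
        ∃ H q : ℝ, 1 ≤ H ∧ 0 < q ∧ q < 1 ∧ IsLocallyWeaklyQuasisymmetric q H f f.source]) ∧
    -- (1) implies (2), with `μ` and `α` depending only on `φ`, `c`, `c'`
    (∀ φ : ℝ≥0 ≃ₜ ℝ≥0, ∃ (μ : ℝ≥0) (α : ℝ), 0 < μ ∧ 0 < α ∧ α < 1 ∧
      ∀ (X : Type u) (Y : Type v) [MetricSpace X] [MetricSpace Y] (f : OpenPartialHomeomorph X Y),
        IsProperDomainHomeo c c' f → IsSemisolidInSubdomains φ f f.source →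
          IsSemisolidInSubdomains (powerControl μ α) f f.source) ∧
    -- (2) implies (1), with `φ` depending only on `μ`, `α`, `c`, `c'`
    (∀ (μ : ℝ≥0) (α : ℝ), 0 < μ → 0 < α → α < 1 → ∃ φ : ℝ≥0 ≃ₜ ℝ≥0,
      ∀ (X : Type u) (Y : Type v) [MetricSpace X] [MetricSpace Y] (f : OpenPartialHomeomorph X Y),
        IsProperDomainHomeo c c' f → IsSemisolidInSubdomains (powerControl μ α) f f.source →
          IsSemisolidInSubdomains φ f f.source) ∧
    -- (1) implies (3), with `H` and `q` depending only on `φ`, `c`, `c'`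
    (∀ φ : ℝ≥0 ≃ₜ ℝ≥0, ∃ H q : ℝ, 1 ≤ H ∧ 0 < q ∧ q < 1 ∧
      ∀ (X : Type u) (Y : Type v) [MetricSpace X] [MetricSpace Y] (f : OpenPartialHomeomorph X Y),
        IsProperDomainHomeo c c' f → IsSemisolidInSubdomains φ f f.source →
          IsLocallyWeaklyQuasisymmetric q H f f.source) ∧
    -- (3) implies (1), with `φ` depending only on `H`, `q`, `c`, `c'`
    (∀ H q : ℝ, 1 ≤ H → 0 < q → q < 1 → ∃ φ : ℝ≥0 ≃ₜ ℝ≥0,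
      ∀ (X : Type u) (Y : Type v) [MetricSpace X] [MetricSpace Y] (f : OpenPartialHomeomorph X Y),
        IsProperDomainHomeo c c' f → IsLocallyWeaklyQuasisymmetric q H f f.source →
          IsSemisolidInSubdomains φ f f.source) ∧
    -- (2) implies (3), with `H` and `q` depending only on `μ`, `α`, `c`, `c'`
    (∀ (μ : ℝ≥0) (α : ℝ), 0 < μ → 0 < α → α < 1 → ∃ H q : ℝ, 1 ≤ H ∧ 0 < q ∧ q < 1 ∧
      ∀ (X : Type u) (Y : Type v) [MetricSpace X] [MetricSpace Y] (f : OpenPartialHomeomorph X Y),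
        IsProperDomainHomeo c c' f → IsSemisolidInSubdomains (powerControl μ α) f f.source →
          IsLocallyWeaklyQuasisymmetric q H f f.source) ∧
    -- (3) implies (2), with `μ` and `α` depending only on `H`, `q`, `c`, `c'`
    (∀ H q : ℝ, 1 ≤ H → 0 < q → q < 1 → ∃ (μ : ℝ≥0) (α : ℝ), 0 < μ ∧ 0 < α ∧ α < 1 ∧
      ∀ (X : Type u) (Y : Type v) [MetricSpace X] [MetricSpace Y] (f : OpenPartialHomeomorph X Y),
        IsProperDomainHomeo c c' f → IsLocallyWeaklyQuasisymmetric q H f f.source →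
          IsSemisolidInSubdomains (powerControl μ α) f f.source) := by
  have h13 := exists_isLocallyWeaklyQuasisymmetric.{u, v} c c'
  have h32 := exists_isSemisolidInSubdomains_powerControl.{u, v} c c'
  have h21 : ∀ (μ : ℝ≥0) (α : ℝ), 0 < μ → 0 < α → α < 1 → ∃ φ : ℝ≥0 ≃ₜ ℝ≥0,
      ∀ (X : Type u) (Y : Type v) [MetricSpace X] [MetricSpace Y] (f : OpenPartialHomeomorph X Y),
        IsProperDomainHomeo c c' f → IsSemisolidInSubdomains (powerControl μ α) f f.source →
          IsSemisolidInSubdomains φ f f.source := by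
    intro μ α hμ hα hα1
    obtain ⟨φ, hφ⟩ := exists_homeomorph_eq_powerControl hμ hα hα1
    exact ⟨φ, fun X Y _ _ f _ h => hφ ▸ h⟩
  refine ⟨fun X Y _ _ f hf => ?_, fun φ => ?_, h21, h13, fun H q hH hq hq1 => ?_,
    fun μ α hμ hα hα1 => ?_, h32⟩
  · tfae_have 1 → 3 := by
      rintro ⟨φ, hφ⟩
      obtain ⟨H, q, hH, hq, hq1, h⟩ := h13 φ
      exact ⟨H, q, hH, hq, hq1, h X Y f hf hφ⟩
    tfae_have 3 → 2 := by
      rintro ⟨H, q, hH, hq, hq1, h⟩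
      obtain ⟨μ, α, hμ, hα, hα1, h'⟩ := h32 H q hH hq hq1
      exact ⟨μ, α, hμ, hα, hα1, h' X Y f hf h⟩
    tfae_have 2 → 1 := by
      rintro ⟨μ, α, hμ, hα, hα1, h⟩
      obtain ⟨φ, hφ⟩ := h21 μ α hμ hα hα1
      exact ⟨φ, hφ X Y f hf h⟩
    tfae_finish
  · obtain ⟨H, q, hH, hq, hq1, h⟩ := h13 φ
    obtain ⟨μ, α, hμ, hα, hα1, h'⟩ := h32 H q hH hq hq1
    exact ⟨μ, α, hμ, hα, hα1, fun X Y _ _ f hf hφ => h' X Y f hf (h X Y f hf hφ)⟩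
  · obtain ⟨μ, α, hμ, hα, hα1, h⟩ := h32 H q hH hq hq1
    obtain ⟨φ, hφ⟩ := h21 μ α hμ hα hα1
    exact ⟨φ, fun X Y _ _ f hf hqs => hφ X Y f hf (h X Y f hf hqs)⟩
  · obtain ⟨φ, hφ⟩ := h21 μ α hμ hα hα1
    obtain ⟨H, q, hH, hq, hq1, h⟩ := h13 φ
    exact ⟨H, q, hH, hq, hq1, fun X Y _ _ f hf hs => h X Y f hf (hφ X Y f hf hs)⟩
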